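/- Let $K$ be a finite field with $q$ elements, let $W$ be a vector space over $K$ (of any dimension), let $m = q+1$, and let $\mathcal U = (U_1,\dots,U_m)$ and $\mathcal V = (V_1,\dots,V_m)$ be tuples of finite-dimensional subspaces of $W$. For $X \subseteq W$ let $1_X$ be its indicator function on $W$, and write $\langle \dots\rangle$ for the $K$-span. Call two tuples equivalent, $\mathcal U\sim\mathcal V$, if there is a permutation $\pi$ of $\{1,\dots,m\}$ with $V_i = U_{\pi(i)}$ for all $i$. Call two pairs $(\mathcal U,\mathcal V)$ and $(\mathcal U',\mathcal V')$ equivalent if either $\mathcal U\sim\mathcal U'$ and $\mathcal V\sim\mathcal V'$, or $\mathcal V\sim\mathcal U'$ and $\mathcal U\sim\mathcal V'$. Call $(\mathcal U,\mathcal V)$ a nontrivial solution if $$\sum_{i=1}^{m}\frac{1}{|V_i|}1_{V_i}=\sum_{i=1}^{m}\frac{1}{|U_i|}1_{U_i}$$ and $\mathcal U\not\sim\mathcal V$. Fix any enumeration $[\alpha_1:\beta_1],\dots,[\alpha_{q+1}:\beta_{q+1}]$ of the points of the projective line $\mathbb P_1(K)$ and any enumeration $\lambda_1,\dots,\lambda_q$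 of the elements of $K$. The pair $(\mathcal U,\mathcal V)$ is * of Type A if there are a subspace $S\subseteq W$ and linearly independent $a,b\in W$ with $S\cap\langle a,b\rangle=\{0\}$ such that $V_1=\dots=V_q=\langle S,a,b\rangle$, $V_{q+1}=S$, and $U_i=\langle S,\alpha_i a+\beta_i b\rangle$ for $1\le i\le q+1$; * of Type B if there are a subspace $S\subseteq W$ and linearly independent $a,b,c\in W$ with $S\cap\langle a,b,c\rangle=\{0\}$ such that $V_{q+1}=\langle S,a\rangle$, $U_{q+1}=\langle S,b\rangle$, and $V_i=\langle S,b,\lambda_i a+c\rangle$, $U_i=\langle S,a,\lambda_i b+c\rangle$ for $1\le i\le q$; * of Type C if there are a subspace $S\subseteq W$ and linearly independent $a,b,c,d\in W$ with $S\cap\langle a,b,c,d\rangle=\{0\}$ such that $V_i=\langle S,\alpha_i a+\beta_i b,\alpha_i c+\beta_i d\rangle$ and $U_i=\langle S,\alpha_i a+\beta_i c,\alpha_i b+\beta_i d\rangle$ for $1\le i\le q+1$. Theorem. Every nontrivial solution $(\mathcal U,\mathcal V)$ (with $m=q+1$) is equivalent to a pair of Type A, Type B or Type C. -/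

import Mathlib

namespace IsometryEquation

open Submodule

variable {K : Type*} [Field K] {W : Type*} [AddCommGroup W] [Module K W]

/-- `(U, V)` satisfies `∑ i, (1 / |V i|) 1_{V i} = ∑ i, (1 / |U i|) 1_{U i}`, as an equality of
functions on `W`. This is meant for tuples of finite subspaces. -/
def IsSolution {m : ℕ} (U V : Fin m → Submodule K W) : Prop :=
  ∀ w : W,
    ∑ i, (1 / (Nat.card (V i) : ℝ)) * Set.indicator (V i : Set W) (fun _ => (1 : ℝ)) w =
      ∑ i, (1 / (Nat.card (U i) : ℝ)) * Set.indicator (U i : Set W) (fun _ => (1 : ℝ)) w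

/-- Two tuples of subspaces are equivalent if they agree up to a permutation of the indices. -/
def TupleEquiv {m : ℕ} (U V : Fin m → Submodule K W) : Prop :=
  ∃ π : Equiv.Perm (Fin m), ∀ i, V i = U (π i)

/-- A solution whose two tuples are not equivalent. -/
def IsNontrivialSolution {m : ℕ} (U V : Fin m → Submodule K W) : Prop :=
  IsSolution U V ∧ ¬ TupleEquiv U V

/-- Equivalence of the pairs `(U, V)` and `(U', V')`: the tuples of the one are equivalent to the
tuples of the other, possibly after swapping. -/
def PairEquiv {m : ℕ} (U V U' V' : Fin m → Submodule K W) : Prop :=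
  (TupleEquiv U U' ∧ TupleEquiv V V') ∨ (TupleEquiv V U' ∧ TupleEquiv U V')

/-- Type A, relative to an enumeration `e` of the projective line: `V 0, …, V (q-1)` are
`⟨S, a, b⟩`, the last `V` is `S`, and `U i = ⟨S, α a + β b⟩` with `[α : β] = e i`. -/
def IsTypeA {q : ℕ} (e : Fin (q + 1) ≃ Projectivization K (Fin 2 → K))
    (U V : Fin (q + 1) → Submodule K W) : Prop :=
  ∃ (S : Submodule K W) (a b : W),
    LinearIndependent K ![a, b] ∧ S ⊓ span K {a, b} = ⊥ ∧
    (∀ i : Fin q, V i.castSucc = S ⊔ span K {a, b}) ∧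
    V (Fin.last q) = S ∧
    ∀ i : Fin (q + 1), U i = S ⊔ span K {(e i).rep 0 • a + (e i).rep 1 • b}

/-- Type B, relative to an enumeration `f` of the field: `V i = ⟨S, b, α a + c⟩` and
`U i = ⟨S, a, α b + c⟩` with `α = f i` for `i < q`; the last spaces are `V = ⟨S, a⟩` and
`U = ⟨S, b⟩`. -/
def IsTypeB {q : ℕ} (f : Fin q ≃ K) (U V : Fin (q + 1) → Submodule K W) : Prop :=
  ∃ (S : Submodule K W) (a b c : W),
    LinearIndependent K ![a, b, c] ∧ S ⊓ span K {a, b, c} = ⊥ ∧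
    V (Fin.last q) = S ⊔ span K {a} ∧
    (∀ i : Fin q, V i.castSucc = S ⊔ span K {b, f i • a + c}) ∧
    U (Fin.last q) = S ⊔ span K {b} ∧
    ∀ i : Fin q, U i.castSucc = S ⊔ span K {a, f i • b + c}

/-- Type C, relative to an enumeration `e` of the projective line: with `[α : β] = e i`,
`V i = ⟨S, α a + β b, α c + β d⟩` and `U i = ⟨S, α a + β c, α b + β d⟩`. -/
def IsTypeC {q : ℕ} (e : Fin (q + 1) ≃ Projectivization K (Fin 2 → K))
    (U V : Fin (q + 1) → Submodule K W) : Prop :=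
  ∃ (S : Submodule K W) (a b c d : W),
    LinearIndependent K ![a, b, c, d] ∧ S ⊓ span K {a, b, c, d} = ⊥ ∧
    (∀ i : Fin (q + 1), V i = S ⊔ span K
      {(e i).rep 0 • a + (e i).rep 1 • b, (e i).rep 0 • c + (e i).rep 1 • d}) ∧
    ∀ i : Fin (q + 1), U i = S ⊔ span K
      {(e i).rep 0 • a + (e i).rep 1 • c, (e i).rep 0 • b + (e i).rep 1 • d}

end IsometryEquation

/-! For a functional `g`, the ratio |P ∩ ker g| / |P| is 1 if `g` kills `P` and 1/q otherwise.
Summing the equation over ker g therefore shows that `g` lies in as many annihilators of the `V i`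
as of the `U i` (`IsSolution.ncard_le_ker_eq`). Splitting off the intersection of all the spaces and
restricting to their sum makes the ambient space finite-dimensional, with trivial total intersection
and full span; duality exchanges these two conditions.

What remains concerns two families A, B of q+1 subspaces that cover every vector equally often. They
share no member: after cancelling it, q subspaces would be left on each side, and these are
determined by their covering multiplicities (`multiset_eq_of_countP_mem_eq`), because no space over
K is a union of q proper subspaces. So a member A_i of largest dimension is covered by the q+1
proper subspaces A_i ∩ B_j. Such a cover consists of hyperplanes, any two of which meet in the
intersection of all. That intersection is zero, whence dim A_i = 2
(`SameMultiplicity.finrank_eq_two`).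

If no B_j is a plane, the configuration is a plane, zero spaces and the lines of the plane (Type A).
If both families contain planes and also some smaller member occurs, each family has exactly one
plane, in dimension 3 (Type B). Otherwise all members are planes in dimension 4, forming two
opposite reguli (Type C). Coordinates are then chosen on the primal side (`exists_typeA`,
`exists_typeB`, `exists_typeC`). -/

namespace IsometryEquation

open Submodule Module

/-! ### Covers of a space by q or q+1 subspaces -/

section Covering

variable {K : Type*} [Field K] {D : Type*} [AddCommGroup D] [Module K D]

theorem eq_of_add_smul_mem {H : Submodule K D} {x y : D} {r s : K} (hx : x ∉ H)
    (hr : y + r • x ∈ H) (hs : y + s • x ∈ H) : r = s := by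
  by_contra hne
  have h : (r - s) • x ∈ H := by
    have := H.sub_mem hr hs
    rwa [add_sub_add_left_eq_sub, ← sub_smul] at this
  exact hx ((H.smul_mem_iff (sub_ne_zero.2 hne)).1 h)

/-- A vector space over a field with `q` elements is not covered by `q` proper subspaces. -/
theorem exists_mem_forall_notMem [Finite K] {ι : Type*} (P : Submodule K D)
    (H : ι → Submodule K D) (s : Finset ι) (hs : s.card ≤ Nat.card K)
    (h : ∀ j ∈ s, ¬ P ≤ H j) : ∃ x ∈ P, ∀ j ∈ s, x ∉ H j := by
  classical
  have := Fintype.ofFinite K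
  induction s using Finset.induction_on with
  | empty => exact ⟨0, P.zero_mem, by simp⟩
  | insert a s ha ih =>
    rw [Finset.card_insert_of_notMem ha] at hs
    obtain ⟨y, hyP, hy⟩ := ih (by omega) fun j hj => h j (Finset.mem_insert_of_mem hj)
    by_cases hya : y ∈ H a
    · obtain ⟨x, hxP, hxa⟩ := SetLike.not_le_iff_exists.1 (h a (Finset.mem_insert_self a s))
      by_contra! hcon
      -- The q points x + r • y avoid `H a`, and each remaining `H j` contains at most one of them
      -- because `y ∉ H j`; but fewer than q subspaces remain.
      have key : ∀ r : K, ∃ j ∈ s, x + r • y ∈ H j := by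
        intro r
        obtain ⟨j, hj, hj'⟩ := hcon (x + r • y) (P.add_mem hxP (P.smul_mem r hyP))
        rcases Finset.mem_insert.1 hj with rfl | hj
        · exact absurd (((H j).add_mem_iff_left ((H j).smul_mem r hya)).1 hj') hxa
        · exact ⟨j, hj, hj'⟩
      choose g hg hg' using key
      have hinj : Function.Injective g := fun r r' hr =>
        eq_of_add_smul_mem (hy _ (hg r)) (hg' r) (hr ▸ hg' r')
      have := Finset.card_le_card_of_injOn (s := Finset.univ) (t := s) g (fun r _ => hg r)
        hinj.injOn
      rw [Finset.card_univ, ← Nat.card_eq_fintype_card] at this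
      omega
    · refine ⟨y, hyP, fun j hj => ?_⟩
      rcases Finset.mem_insert.1 hj with rfl | hj
      exacts [hya, hy j hj]

/-- A vector space that is covered by at most `q` subspaces is contained in one of them. -/
theorem exists_le_of_cover [Finite K] {ι : Type*} {P : Submodule K D}
    {H : ι → Submodule K D} {s : Finset ι} (hs : s.card ≤ Nat.card K)
    (hc : ∀ x ∈ P, ∃ j ∈ s, x ∈ H j) : ∃ j ∈ s, P ≤ H j := by
  by_contra! hcon
  obtain ⟨x, hx, hx'⟩ := exists_mem_forall_notMem P H s hs hcon
  obtain ⟨j, hj, hj'⟩ := hc x hx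
  exact hx' j hj hj'

section Cover

variable [Finite K] {ι : Type*} [Fintype ι] {P : Submodule K D} {H : ι → Submodule K D}

/-- Without `H l` only q proper subspaces are left, so they miss a point of `P`, and only `H l` can
contain it. -/
theorem exists_mem_unique_of_cover (hι : Fintype.card ι = Nat.card K + 1)
    (hc : ∀ x ∈ P, ∃ j, x ∈ H j) (hP : ∀ j, ¬ P ≤ H j)
    (l : ι) : ∃ x ∈ P, x ∈ H l ∧ ∀ j, j ≠ l → x ∉ H j := by
  classical
  obtain ⟨x, hx, hx'⟩ := exists_mem_forall_notMem P H (Finset.univ.erase l)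
    (by rw [Finset.card_erase_of_mem (Finset.mem_univ l), Finset.card_univ]; omega)
    fun j _ => hP j
  have hx'' : ∀ j, j ≠ l → x ∉ H j := fun j hj => hx' j (by simp [hj])
  obtain ⟨j, hj⟩ := hc x hx
  by_cases hjl : j = l
  · exact ⟨x, hx, hjl ▸ hj, hx''⟩
  · exact absurd hj (hx'' j hjl)

/-- The affine line y + K x never meets `H l` and meets every other `H j` at most once. Its q points
must be covered by q subspaces, so each gets exactly one. -/
theorem exists_bijective_of_cover (hι : Fintype.card ι = Nat.card K + 1)
    (hc : ∀ x ∈ P, ∃ j, x ∈ H j) 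
    {l : ι} {x : D} (hx : x ∈ P) (hxl : x ∈ H l)
    (hx' : ∀ j, j ≠ l → x ∉ H j) {y : D} (hy : y ∈ P) (hyl : y ∉ H l) :
    ∃ g : K → {j // j ≠ l}, Function.Bijective g ∧ ∀ r, y + r • x ∈ H (g r) := by
  classical
  have := Fintype.ofFinite K
  have key : ∀ r : K, ∃ j : {j // j ≠ l}, y + r • x ∈ H j := by
    intro r
    obtain ⟨j, hj⟩ := hc (y + r • x) (P.add_mem hy (P.smul_mem r hx))
    refine ⟨⟨j, ?_⟩, hj⟩
    rintro rfl
    exact hyl (((H j).add_mem_iff_left ((H j).smul_mem r hxl)).1 hj)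
  choose g hg using key
  refine ⟨g, ?_, hg⟩
  rw [Fintype.bijective_iff_injective_and_card]
  refine ⟨fun r r' hr => eq_of_add_smul_mem (hx' _ (g r).2) (hg r) (hr ▸ hg r'), ?_⟩
  have := Fintype.card_subtype_compl (fun j : ι => j = l)
  simp only [Fintype.card_subtype_eq] at this
  rw [← Nat.card_eq_fintype_card (α := K)]
  simp only [ne_eq, this, hι]
  simp

/-- If `y` avoided `H l`, the point r = 0 of the line through `y` would be assigned by the bijection
to both `j` and `k`. -/
theorem inf_inf_le_of_cover (hι : Fintype.card ι = Nat.card K + 1)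
    (hc : ∀ x ∈ P, ∃ j, x ∈ H j) (hP : ∀ j, ¬ P ≤ H j)
    {j k : ι} (hjk : j ≠ k) (l : ι) : P ⊓ H j ⊓ H k ≤ H l := by
  rintro y ⟨⟨hy, hyj⟩, hyk⟩
  by_contra hyl
  obtain ⟨x, hx, hxl, hx'⟩ := exists_mem_unique_of_cover hι hc hP l
  obtain ⟨g, hg, hg'⟩ := exists_bijective_of_cover hι hc hx hxl hx' hy hyl
  have hzero : ∀ i, i ≠ l → y ∈ H i → (g 0 : ι) = i := by
    intro i hil hyi
    obtain ⟨r, hr⟩ := hg.2 ⟨i, hil⟩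
    have h1 := hg' r
    rw [hr] at h1
    have : r = 0 := eq_of_add_smul_mem (y := y) (hx' i hil) h1 (by simpa using hyi)
    rw [← this, hr]
  have hjl : j ≠ l := by rintro rfl; exact hyl hyj
  have hkl : k ≠ l := by rintro rfl; exact hyl hyk
  exact hjk ((hzero j hjl hyj).symm.trans (hzero k hkl hyk))

theorem inf_ne_inf_of_cover (hι : Fintype.card ι = Nat.card K + 1)
    (hc : ∀ x ∈ P, ∃ j, x ∈ H j) (hP : ∀ j, ¬ P ≤ H j)
    {j k : ι} (hjk : j ≠ k) : P ⊓ H j ≠ P ⊓ H k := by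
  intro h
  obtain ⟨x, hx, hxl, hx'⟩ := exists_mem_unique_of_cover hι hc hP j
  have : x ∈ P ⊓ H k := h ▸ ⟨hx, hxl⟩
  exact hx' k hjk.symm this.2

theorem finrank_inf_add_one_of_cover [FiniteDimensional K D]
    (hι : Fintype.card ι = Nat.card K + 1)
    (hc : ∀ x ∈ P, ∃ j, x ∈ H j) (hP : ∀ j, ¬ P ≤ H j) (j : ι) :
    finrank K (P ⊓ H j : Submodule K D) + 1 = finrank K P := by
  have hq : 1 < Nat.card K := Finite.one_lt_card
  obtain ⟨l, hl⟩ := Fintype.exists_ne_of_one_lt_card (by omega : 1 < Fintype.card ι) j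
  obtain ⟨x, hx, hxl, hx'⟩ := exists_mem_unique_of_cover hι hc hP l
  have h1 : ∀ y ∈ P, y ∉ H l → y ∈ P ⊓ H j ⊔ span K {x} := by
    intro y hy hyl
    obtain ⟨g, hg, hg'⟩ := exists_bijective_of_cover hι hc hx hxl hx' hy hyl
    obtain ⟨r, hr⟩ := hg.2 ⟨j, hl.symm⟩
    have h2 := hg' r
    rw [hr] at h2
    have : y = (y + r • x) + (-r) • x := by simp
    rw [this]
    exact add_mem (mem_sup_left ⟨P.add_mem hy (P.smul_mem r hx), h2⟩)
      (mem_sup_right (smul_mem _ _ (mem_span_singleton_self x)))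
  have h2 : P ≤ P ⊓ H j ⊔ span K {x} := by
    intro y hy
    -- A point of `H l` is a difference of two points of `P` outside `H l`.
    by_cases hyl : y ∈ H l
    · obtain ⟨z, hz, hzl⟩ := SetLike.not_le_iff_exists.1 (hP l)
      have := sub_mem (h1 (y + z) (P.add_mem hy hz) fun h => hzl (((H l).add_mem_iff_right hyl).1 h))
        (h1 z hz hzl)
      simpa using this
    · exact h1 y hy hyl
  have h3 := (finrank_mono h2).trans (finrank_add_le_finrank_add_finrank _ _)
  have h4 := finrank_span_le_card (R := K) ({x} : Set D)
  simp only [Set.toFinset_singleton, Finset.card_singleton] at h4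
  have h5 : P ⊓ H j < P := lt_of_le_of_ne inf_le_left fun h => hP j (inf_eq_left.1 h)
  have h6 := finrank_lt_finrank_of_lt h5
  omega

end Cover

/-- Multisets of at most `q` subspaces are determined by the multiplicities with which they cover
the points. -/
theorem multiset_eq_of_countP_mem_eq [Finite K] [FiniteDimensional K D]
    [∀ x, DecidablePred fun P : Submodule K D => x ∈ P]
    (s t : Multiset (Submodule K D)) (hs : s.card ≤ Nat.card K)
    (h : ∀ x, s.countP (x ∈ ·) = t.countP (x ∈ ·)) : s = t := by
  classical
  have hcard : s.card = t.card := by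
    -- The zero vector lies in every member, so its multiplicity is the cardinality.
    have h0 := h 0
    rwa [Multiset.countP_eq_card.2 fun P _ => P.zero_mem,
      Multiset.countP_eq_card.2 fun P _ => P.zero_mem] at h0
  induction hn : s.card generalizing s t with
  | zero =>
    rw [Multiset.card_eq_zero.1 hn, Multiset.card_eq_zero.1 (hcard.symm.trans hn)]
  | succ n ih =>
    -- A member of largest dimension is covered by at most q members of the other multiset, so it
    -- lies in one of them and equals it by dimension. Removing this common member allows induction.
    have aux : ∀ s t : Multiset (Submodule K D), t.card ≤ Nat.card K →
        (∀ x, s.countP (x ∈ ·) = t.countP (x ∈ ·)) → ∀ P ∈ s,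
        (∀ R ∈ t, finrank K R ≤ finrank K P) → P ∈ t := by
      intro s t ht h P hP hmax
      obtain ⟨R, hR, hle⟩ := exists_le_of_cover (P := P) (H := id) (s := t.toFinset)
        ((Multiset.toFinset_card_le t).trans ht) (by
          intro x hx
          have : 0 < s.countP (x ∈ ·) := Multiset.countP_pos.2 ⟨P, hP, hx⟩
          rw [h, Multiset.countP_pos] at this
          simpa using this)
      have hR' : R ∈ t := Multiset.mem_toFinset.1 hR
      rwa [eq_of_le_of_finrank_le hle (hmax R hR')]
    have hcommon : ∃ P, P ∈ s ∧ P ∈ t := by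
      have hne : (s + t).toFinset.Nonempty := by
        obtain ⟨P, hP⟩ := Multiset.card_pos_iff_exists_mem.1 (by omega : 0 < s.card)
        exact ⟨P, by simp [hP]⟩
      obtain ⟨P, hP, hmax⟩ := (s + t).toFinset.exists_max_image (fun P => finrank K P) hne
      rw [Multiset.mem_toFinset, Multiset.mem_add] at hP
      have hmax' : ∀ R, R ∈ s ∨ R ∈ t → finrank K R ≤ finrank K P := by
        intro R hR
        exact hmax R (by simpa using hR)
      rcases hP with hP | hP
      · exact ⟨P, hP, aux s t (by omega) h P hP fun R hR => hmax' R (Or.inr hR)⟩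
      · exact ⟨P, aux t s hs (fun x => (h x).symm) P hP fun R hR => hmax' R (Or.inl hR), hP⟩
    obtain ⟨P, hPs, hPt⟩ := hcommon
    obtain ⟨s, rfl⟩ := Multiset.exists_cons_of_mem hPs
    obtain ⟨t, rfl⟩ := Multiset.exists_cons_of_mem hPt
    simp only [Multiset.card_cons] at hs hcard hn
    rw [ih s t (by omega) (fun x => by have := h x; simp only [Multiset.countP_cons] at this; omega)
      (by omega) (by omega)]

end Covering

/-! ### Two families of q+1 subspaces with equal covering multiplicities -/

section Multiplicity

variable {K : Type*} [Field K] {D : Type*} [AddCommGroup D] [Module K D]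

/-- Two families of subspaces cover every vector equally often. -/
def SameMultiplicity {ι : Type*} (A B : ι → Submodule K D) : Prop :=
  ∀ x, {i | x ∈ A i}.ncard = {i | x ∈ B i}.ncard

namespace SameMultiplicity

variable {ι : Type*} {A B : ι → Submodule K D}

theorem symm (h : SameMultiplicity A B) : SameMultiplicity B A := fun x => (h x).symm

theorem not_le_of_forall_finrank_le [FiniteDimensional K D] (hd : ∀ i j, A i ≠ B j)
    {i : ι} (hmax : ∀ j, finrank K (B j) ≤ finrank K (A i)) (j : ι) : ¬ A i ≤ B j :=
  fun hle => hd i j (eq_of_le_of_finrank_le hle (hmax j))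

variable [Fintype ι]

theorem exists_mem (h : SameMultiplicity A B) {x : D} {i : ι} (hi : x ∈ A i) :
    ∃ j, x ∈ B j := by
  have : 0 < {i | x ∈ A i}.ncard := (Set.ncard_pos (Set.toFinite _)).2 ⟨i, hi⟩
  rw [h] at this
  exact (Set.ncard_pos (Set.toFinite _)).1 this

theorem exists_two_mem (h : SameMultiplicity A B) {x : D} {i i' : ι} (hne : i ≠ i')
    (hi : x ∈ A i) (hi' : x ∈ A i') : ∃ j j', j ≠ j' ∧ x ∈ B j ∧ x ∈ B j' := by
  have : 1 < {i | x ∈ A i}.ncard := (Set.one_lt_ncard (Set.toFinite _)).2 ⟨i, hi, i', hi', hne⟩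
  rw [h] at this
  obtain ⟨j, hj, j', hj', hjj⟩ := (Set.one_lt_ncard (Set.toFinite _)).1 this
  exact ⟨j, j', hjj, hj, hj'⟩

theorem forall_mem (h : SameMultiplicity A B) {x : D} (hx : ∀ i, x ∈ A i) (j : ι) :
    x ∈ B j := by
  have h1 : {i | x ∈ A i} = Set.univ := Set.eq_univ_of_forall hx
  have h2 := h x
  rw [h1] at h2
  have : {i | x ∈ B i} = Set.univ := by
    refine Set.eq_of_subset_of_ncard_le (Set.subset_univ _) h2.le (Set.toFinite _)
  exact Set.eq_univ_iff_forall.1 this j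

/-- Cancelling the common member leaves q subspaces on each side, which their multiplicities
determine. For inequivalent families this excludes common members, the hypothesis `hd` below. -/
theorem exists_perm_of_common [Finite K] [FiniteDimensional K D] (h : SameMultiplicity A B)
    (hι : Fintype.card ι = Nat.card K + 1) {i j : ι} (hij : A i = B j) :
    ∃ π : Equiv.Perm ι, ∀ k, A k = B (π k) := by
  classical
  set s := (Finset.univ : Finset ι).val.map A with hs
  set t := (Finset.univ : Finset ι).val.map B with ht
  have hcs : s.card = Nat.card K + 1 := by simp [hs, hι]
  have hcount : ∀ x, s.countP (x ∈ ·) = t.countP (x ∈ ·) := by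
    intro x
    have := h x
    rw [Set.ncard_eq_toFinset_card', Set.ncard_eq_toFinset_card'] at this
    simpa [hs, ht, Multiset.countP_map, Finset.card_def, Finset.filter_val] using this
  obtain ⟨s', hs'⟩ := Multiset.exists_cons_of_mem (show A i ∈ s by simp [hs])
  obtain ⟨t', ht'⟩ := Multiset.exists_cons_of_mem (show A i ∈ t by rw [hij]; simp [ht])
  have hst : s = t := by
    rw [hs', ht', multiset_eq_of_countP_mem_eq s' t'
      (by rw [hs', Multiset.card_cons] at hcs; omega)]
    intro x
    have := hcount x
    rw [hs', ht', Multiset.countP_cons, Multiset.countP_cons] at this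
    omega
  -- Equal multisets of values have fibres of equal size; bijections of the fibres glue to a
  -- permutation.
  have hfib : ∀ P, Nonempty ({k // A k = P} ≃ {k // B k = P}) := by
    intro P
    refine ⟨Fintype.equivOfCardEq ?_⟩
    have := congrArg (Multiset.count P) hst
    rw [hs, ht, Multiset.count_map, Multiset.count_map] at this
    rw [Fintype.card_subtype, Fintype.card_subtype]
    simpa [Finset.card_def, Finset.filter_val, eq_comm] using this
  exact ⟨Equiv.ofFiberEquiv fun P => (hfib P).some, fun k => (Equiv.ofFiberEquiv_map _ k).symm⟩

variable [FiniteDimensional K D]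

variable [Finite K]

theorem finrank_inf_add_one (h : SameMultiplicity A B) (hι : Fintype.card ι = Nat.card K + 1)
    (hd : ∀ i j, A i ≠ B j) {i : ι} (hmax : ∀ j, finrank K (B j) ≤ finrank K (A i)) (j : ι) :
    finrank K (A i ⊓ B j : Submodule K D) + 1 = finrank K (A i) :=
  finrank_inf_add_one_of_cover hι (fun _ hx => h.exists_mem hx)
    (not_le_of_forall_finrank_le hd hmax) j

theorem inf_ne_inf (h : SameMultiplicity A B) (hι : Fintype.card ι = Nat.card K + 1)
    (hd : ∀ i j, A i ≠ B j) {i : ι} (hmax : ∀ j, finrank K (B j) ≤ finrank K (A i)) {j k : ι}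
    (hjk : j ≠ k) : A i ⊓ B j ≠ A i ⊓ B k :=
  inf_ne_inf_of_cover hι (fun _ hx => h.exists_mem hx)
    (not_le_of_forall_finrank_le hd hmax) hjk

theorem inf_inf_eq_bot (h : SameMultiplicity A B) (hι : Fintype.card ι = Nat.card K + 1)
    (hd : ∀ i j, A i ≠ B j) (hbot : ∀ x, (∀ i, x ∈ B i) → x = 0) {i : ι}
    (hmax : ∀ j, finrank K (B j) ≤ finrank K (A i)) {j k : ι} (hjk : j ≠ k) :
    A i ⊓ B j ⊓ B k = ⊥ := by
  rw [eq_bot_iff]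
  intro x hx
  exact hbot x fun l => inf_inf_le_of_cover hι (fun _ hx => h.exists_mem hx)
    (not_le_of_forall_finrank_le hd hmax) hjk l hx

/-- Two of the hyperplanes A_i ∩ B_j meet trivially, so dim A_i ≤ 2; they are distinct, so dim A_i
is not 1. -/
theorem finrank_eq_two (h : SameMultiplicity A B) (hι : Fintype.card ι = Nat.card K + 1)
    (hd : ∀ i j, A i ≠ B j) (hbot : ∀ x, (∀ i, x ∈ B i) → x = 0) {i : ι}
    (hmax : ∀ j, finrank K (B j) ≤ finrank K (A i)) : finrank K (A i) = 2 := by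
  have hq : 1 < Nat.card K := Finite.one_lt_card
  obtain ⟨k, hk⟩ := Fintype.exists_ne_of_one_lt_card (by omega : 1 < Fintype.card ι) i
  have h1 := h.inf_inf_eq_bot hι hd hbot hmax hk
  have h2 := h.inf_ne_inf hι hd hmax hk
  have hk' := h.finrank_inf_add_one hι hd hmax k
  have hi' := h.finrank_inf_add_one hι hd hmax i
  have h3 := finrank_sup_add_finrank_inf_eq (A i ⊓ B k) (A i ⊓ B i)
  have h4 : A i ⊓ B k ⊓ (A i ⊓ B i) = ⊥ := by rw [← inf_inf_distrib_left, ← inf_assoc, h1]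
  rw [h4, finrank_bot] at h3
  have h5 := finrank_mono (sup_le inf_le_left inf_le_left : A i ⊓ B k ⊔ A i ⊓ B i ≤ A i)
  by_contra hne
  have h6 : finrank K (A i ⊓ B k : Submodule K D) = 0 := by omega
  have h7 : finrank K (A i ⊓ B i : Submodule K D) = 0 := by omega
  exact h2 ((finrank_eq_zero.1 h6).trans (finrank_eq_zero.1 h7).symm)

/-- The case in which one subspace is strictly larger than all subspaces of the other family. -/
theorem structure_of_forall_finrank_lt (h : SameMultiplicity A B)
    (hι : Fintype.card ι = Nat.card K + 1) (hd : ∀ i j, A i ≠ B j)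
    (hbot : ∀ x, (∀ i, x ∈ B i) → x = 0)
    (htop : ∀ T, (∀ i, A i ≤ T) → (∀ i, B i ≤ T) → T = ⊤) {i : ι}
    (hlt : ∀ j, finrank K (B j) < finrank K (A i)) :
    finrank K D = 2 ∧ A i = ⊤ ∧ (∀ k, k ≠ i → A k = ⊥) ∧ Function.Injective B ∧
      ∀ j, finrank K (B j) = 1 := by
  have hmax := fun j => (hlt j).le
  have htwo := h.finrank_eq_two hι hd hbot hmax
  have hle : ∀ j, B j ≤ A i := by
    intro j
    have h1 := h.finrank_inf_add_one hι hd hmax j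
    have h2 := hlt j
    have : A i ⊓ B j = B j := eq_of_le_of_finrank_le inf_le_right (by omega)
    exact inf_eq_right.1 this
  have hinf : ∀ j, A i ⊓ B j = B j := fun j => inf_eq_right.2 (hle j)
  -- A vector of `A k` lies in some `B j`, hence also in `A i`. Being covered twice by A, it is
  -- covered twice by B, and two members of B meet trivially inside `A i`.
  have hA : ∀ k, k ≠ i → A k = ⊥ := by
    intro k hk
    rw [eq_bot_iff]
    intro x hx
    obtain ⟨j, hj⟩ := h.exists_mem hx
    obtain ⟨j, j', hjj, hj, hj'⟩ := h.exists_two_mem hk hx (hle j hj)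
    rw [← h.inf_inf_eq_bot hι hd hbot hmax hjj]
    exact ⟨⟨hle j hj, hj⟩, hj'⟩
  have hi : A i = ⊤ := by
    refine htop _ (fun k => ?_) hle
    by_cases hk : k = i
    · rw [hk]
    · rw [hA k hk]; exact bot_le
  refine ⟨by rw [← htwo, hi, finrank_top], hi, hA, ?_, ?_⟩
  · intro j k hjk
    by_contra hne
    exact h.inf_ne_inf hι hd hmax hne (by rw [hjk])
  · intro j
    have h1 := h.finrank_inf_add_one hι hd hmax j
    rw [hinf] at h1
    omega

/-- The plane `B j` has maximal dimension, so it meets `A k` in a line, and `A k` is too small to be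
more than that line. -/
theorem le_of_finrank_lt_two (h : SameMultiplicity A B)
    (hι : Fintype.card ι = Nat.card K + 1) (hd : ∀ i j, A i ≠ B j)
    (hA : ∀ i, finrank K (A i) ≤ 2) {k j : ι} (hk : finrank K (A k) < 2)
    (hj : finrank K (B j) = 2) : A k ≤ B j ∧ finrank K (A k) = 1 := by
  have h1 := h.symm.finrank_inf_add_one hι (fun i j => (hd j i).symm)
    (i := j) (fun i => (hA i).trans hj.ge) k
  have : B j ⊓ A k = A k := eq_of_le_of_finrank_le inf_le_right (by omega)
  exact ⟨inf_eq_right.1 this, by rw [this] at h1; omega⟩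

/-- Suppose B had two planes. Both contain `A k`, so every vector of `A k` is covered twice by B,
hence twice by A. The q other members of A then cover `A k`, and one of them, `A i`, contains it.
Now `A i` and `A k` cut the same line out of `B j`, which is impossible. -/
theorem eq_of_finrank_eq_two (h : SameMultiplicity A B)
    (hι : Fintype.card ι = Nat.card K + 1) (hd : ∀ i j, A i ≠ B j)
    (hA : ∀ i, finrank K (A i) ≤ 2) {k j j' : ι} (hk : finrank K (A k) < 2)
    (hj : finrank K (B j) = 2) (hj' : finrank K (B j') = 2) : j = j' := by
  classical
  by_contra hne
  obtain ⟨i, hi, hle⟩ := exists_le_of_cover (P := A k) (H := A) (s := Finset.univ.erase k)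
    (by rw [Finset.card_erase_of_mem (Finset.mem_univ k), Finset.card_univ]; omega) (by
      intro x hx
      obtain ⟨i, i', hii, hi, hi'⟩ := h.symm.exists_two_mem hne
        ((h.le_of_finrank_lt_two hι hd hA hk hj).1 hx)
        ((h.le_of_finrank_lt_two hι hd hA hk hj').1 hx)
      by_cases hik : i = k
      · exact ⟨i', by simp [← hik, hii.symm], hi'⟩
      · exact ⟨i, by simp [hik], hi⟩)
  have hi : i ≠ k := by simpa using hi
  have hmax : ∀ i, finrank K (A i) ≤ finrank K (B j) := fun i => (hA i).trans hj.ge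
  have hd' := fun i j => (hd j i).symm
  refine h.symm.inf_ne_inf hι hd' hmax hi (eq_of_le_of_finrank_le ?_ ?_).symm
  · exact le_inf inf_le_left (inf_le_right.trans hle)
  · have h1 := h.symm.finrank_inf_add_one hι hd' hmax i
    have h2 := h.symm.finrank_inf_add_one hι hd' hmax k
    omega

/-- The case of planes `A i`, `B j` and lines otherwise, seen from the family `A`. -/
theorem structure_of_unique_plane (h : SameMultiplicity A B)
    (hι : Fintype.card ι = Nat.card K + 1) (hd : ∀ i j, A i ≠ B j)
    (hA : ∀ i, finrank K (A i) ≤ 2) {i j : ι}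
    (hj : finrank K (B j) = 2)
    (hi' : ∀ k, k ≠ i → finrank K (A k) < 2) {k : ι} (hk : k ≠ i) :
    finrank K (A k) = 1 ∧ A k ≤ B j ∧ ¬ A k ≤ A i ∧ ∀ l, A k = A l → k = l := by
  have hmax : ∀ i, finrank K (A i) ≤ finrank K (B j) := fun i => (hA i).trans hj.ge
  have hd' := fun i j => (hd j i).symm
  obtain ⟨h1, h2⟩ := h.le_of_finrank_lt_two hι hd hA (hi' k hk) hj
  refine ⟨h2, h1, fun hle => ?_, fun l hkl => ?_⟩
  · refine h.symm.inf_ne_inf hι hd' hmax hk (eq_of_le_of_finrank_le ?_ ?_)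
    · exact le_inf inf_le_left (inf_le_right.trans hle)
    · have h1 := h.symm.finrank_inf_add_one hι hd' hmax i
      have h2 := h.symm.finrank_inf_add_one hι hd' hmax k
      omega
  · by_contra hne
    exact h.symm.inf_ne_inf hι hd' hmax hne (by rw [hkl])

/-- The case in which the maximal dimension occurs in both families, but a smaller dimension occurs
too. -/
theorem finrank_eq_three (h : SameMultiplicity A B)
    (hι : Fintype.card ι = Nat.card K + 1) (hd : ∀ i j, A i ≠ B j)
    (htop : ∀ T, (∀ i, A i ≤ T) → (∀ i, B i ≤ T) → T = ⊤)
    (hA : ∀ i, finrank K (A i) ≤ 2) (hB : ∀ i, finrank K (B i) ≤ 2) {i j : ι}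
    (hi : finrank K (A i) = 2) (hj : finrank K (B j) = 2)
    (hi' : ∀ k, k ≠ i → finrank K (A k) < 2) (hj' : ∀ k, k ≠ j → finrank K (B k) < 2) :
    finrank K D = 3 := by
  have hsup : A i ⊔ B j = ⊤ := by
    refine htop _ (fun k => ?_) (fun k => ?_)
    · by_cases hk : k = i
      · exact hk ▸ le_sup_left
      · exact (h.structure_of_unique_plane hι hd hA hj hi' hk).2.1.trans le_sup_right
    · by_cases hk : k = j
      · exact hk ▸ le_sup_right
      · exact (h.symm.structure_of_unique_plane hι (fun i j => (hd j i).symm)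
          hB hi hj' hk).2.1.trans le_sup_left
  have h1 := finrank_sup_add_finrank_inf_eq (A i) (B j)
  have h2 := h.finrank_inf_add_one hι hd (i := i) (fun j => (hB j).trans hi.ge) j
  rw [hsup, finrank_top] at h1
  omega

/-- A small `A k` forces a unique plane in B; this makes some `B l` small, which forces a unique
plane in A. -/
theorem exists_unique_planes (h : SameMultiplicity A B)
    (hι : Fintype.card ι = Nat.card K + 1) (hd : ∀ i j, A i ≠ B j)
    (hA : ∀ i, finrank K (A i) ≤ 2) (hB : ∀ i, finrank K (B i) ≤ 2) {i j k : ι}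
    (hi : finrank K (A i) = 2) (hj : finrank K (B j) = 2) (hk : finrank K (A k) < 2) :
    (∀ l, l ≠ i → finrank K (A l) < 2) ∧ ∀ l, l ≠ j → finrank K (B l) < 2 := by
  have hq : 1 < Nat.card K := Finite.one_lt_card
  have h1 : ∀ l, l ≠ j → finrank K (B l) < 2 := fun l hl =>
    lt_of_le_of_ne (hB l) fun hl' => hl (h.eq_of_finrank_eq_two hι hd hA hk hl' hj)
  obtain ⟨l, hl⟩ := Fintype.exists_ne_of_one_lt_card (by omega : 1 < Fintype.card ι) j
  exact ⟨fun m hm => lt_of_le_of_ne (hA m) fun hm' => hm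
    (h.symm.eq_of_finrank_eq_two hι (fun i j => (hd j i).symm) hB (h1 l hl) hm' hi), h1⟩

/-- The case in which all dimensions agree. -/
theorem structure_of_forall_finrank_eq_two (h : SameMultiplicity A B)
    (hι : Fintype.card ι = Nat.card K + 1) (hd : ∀ i j, A i ≠ B j)
    (hbot : ∀ x, (∀ i, x ∈ B i) → x = 0)
    (htop : ∀ T, (∀ i, A i ≤ T) → (∀ i, B i ≤ T) → T = ⊤)
    (hA : ∀ i, finrank K (A i) = 2) (hB : ∀ i, finrank K (B i) = 2) :
    finrank K D = 4 ∧ (∀ i k, i ≠ k → A i ⊓ A k = ⊥) ∧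
      ∀ i j, finrank K (A i ⊓ B j : Submodule K D) = 1 := by
  have hq : 1 < Nat.card K := Finite.one_lt_card
  have hmax : ∀ i j, finrank K (B j) ≤ finrank K (A i) := fun i j => by rw [hA, hB]
  have hmax' : ∀ i j, finrank K (A j) ≤ finrank K (B i) := fun i j => by rw [hA, hB]
  have hd' := fun i j => (hd j i).symm
  have hone : ∀ i j, finrank K (A i ⊓ B j : Submodule K D) = 1 := by
    intro i j
    have := h.finrank_inf_add_one hι hd (hmax i) j
    rw [hA] at this
    omega
  have hdis : ∀ i k, i ≠ k → A i ⊓ A k = ⊥ := by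
    intro i k hik
    rw [eq_bot_iff]
    rintro x ⟨hi, hk⟩
    obtain ⟨j, j', hjj, hj, hj'⟩ := h.exists_two_mem hik hi hk
    rw [← h.inf_inf_eq_bot hι hd hbot (hmax i) hjj]
    exact ⟨⟨hi, hj⟩, hj'⟩
  -- The plane `A i` is spanned by the distinct lines it shares with `B j` and `B k`. The families
  -- are bound anew so that this also applies with the roles exchanged.
  have hle : ∀ {A B : ι → Submodule K D} (_ : SameMultiplicity A B) (_ : ∀ i j, A i ≠ B j)
      (_ : ∀ i, finrank K (A i) = 2) (_ : ∀ i j, finrank K (B j) ≤ finrank K (A i))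
      (i j k : ι), j ≠ k → A i ≤ B j ⊔ B k := by
    intro A B h hd hA hmax i j k hjk
    have h1 := h.inf_ne_inf hι hd (hmax i) hjk
    have h2 := h.finrank_inf_add_one hι hd (hmax i) j
    have h3 := h.finrank_inf_add_one hι hd (hmax i) k
    have h4 : A i ⊓ B j < A i ⊓ B j ⊔ A i ⊓ B k := by
      refine lt_of_le_of_ne le_sup_left fun heq => h1 ?_
      exact (eq_of_le_of_finrank_le (heq ▸ le_sup_right) (by omega)).symm
    have h5 := finrank_lt_finrank_of_lt h4
    have h6 := eq_of_le_of_finrank_le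
      (sup_le inf_le_left inf_le_left : A i ⊓ B j ⊔ A i ⊓ B k ≤ A i) (by omega)
    calc A i = A i ⊓ B j ⊔ A i ⊓ B k := h6.symm
      _ ≤ _ := sup_le_sup inf_le_right inf_le_right
  have hιne : 1 < Fintype.card ι := by omega
  obtain ⟨i, k, hik⟩ := Fintype.exists_pair_of_one_lt_card hιne
  have hBle : ∀ j, B j ≤ A i ⊔ A k := fun j => hle h.symm hd' hB hmax' j i k hik
  have hsup : A i ⊔ A k = ⊤ := htop _
    (fun l => (hle h hd hA hmax l i k hik).trans (sup_le (hBle i) (hBle k))) hBle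
  have h1 := finrank_sup_add_finrank_inf_eq (A i) (A k)
  rw [hsup, finrank_top, hdis i k hik, finrank_bot, hA, hA] at h1
  exact ⟨by omega, hdis, hone⟩

end SameMultiplicity

end Multiplicity

/-! ### Coordinates for the three configurations -/

section Coordinates

variable {K : Type*} [Field K] {W : Type*} [AddCommGroup W] [Module K W]

/-- An injective self-map of a finite index set is a permutation, so it suffices to find each member
of one tuple in the other. -/
theorem tupleEquiv_of_injective {m : ℕ} {U U' : Fin m → Submodule K W}
    (hU : Function.Injective U) (h : ∀ i, ∃ j, U i = U' j) : TupleEquiv U U' := by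
  choose g hg using h
  have hinj : Function.Injective g := fun i j hij => hU (by rw [hg, hg j, hij])
  have hbij := Finite.injective_iff_bijective.1 hinj
  refine ⟨(Equiv.ofBijective g hbij).symm, fun i => ?_⟩
  rw [hg]
  congr 1
  exact ((Equiv.ofBijective g hbij).apply_symm_apply i).symm

/-- The representative of a projective point is an arbitrary choice, which accounts for the factor
`t`. -/
theorem exists_rep_eq_mul {n : ℕ} (e : Fin n ≃ Projectivization K (Fin 2 → K)) {α β : K}
    (h : α ≠ 0 ∨ β ≠ 0) :
    ∃ i, ∃ t : K, t ≠ 0 ∧ (e i).rep 0 = t * α ∧ (e i).rep 1 = t * β := by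
  have hv : ![α, β] ≠ 0 := by
    intro h0
    rcases h with h | h
    · exact h (by simpa using congrFun h0 0)
    · exact h (by simpa using congrFun h0 1)
  obtain ⟨t, ht⟩ := Projectivization.exists_smul_eq_mk_rep K ![α, β] hv
  refine ⟨e.symm (Projectivization.mk K ![α, β] hv), t, t.ne_zero, ?_, ?_⟩
  · rw [Equiv.apply_symm_apply, ← ht]; simp [Units.smul_def]
  · rw [Equiv.apply_symm_apply, ← ht]; simp [Units.smul_def]

theorem eq_span_singleton_of_finrank_eq_one {P : Submodule K W} (hP : finrank K P = 1) {x : W}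
    (hx : x ∈ P) (hx0 : x ≠ 0) : P = span K {x} := by
  have : FiniteDimensional K P := FiniteDimensional.of_finrank_pos (by omega)
  refine (eq_of_le_of_finrank_le (by simpa using hx) ?_).symm
  rw [finrank_span_singleton hx0, hP]

theorem eq_span_pair_of_finrank_eq_two {P : Submodule K W} (hP : finrank K P = 2) {x y : W}
    (hx : x ∈ P) (hy : y ∈ P) (hxy : LinearIndependent K ![x, y]) : P = span K {x, y} := by
  have : FiniteDimensional K P := FiniteDimensional.of_finrank_pos (by omega)
  refine (eq_of_le_of_finrank_le ?_ ?_).symm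
  · rw [span_le]
    rintro z (rfl | rfl)
    exacts [hx, hy]
  · have := finrank_span_eq_card hxy
    rw [Matrix.range_cons_cons_empty] at this
    rw [this, hP, Fintype.card_fin]

theorem linearIndependent_pair_of_inf_eq_bot {P R : Submodule K W} (h : P ⊓ R = ⊥) {x y : W}
    (hx : x ∈ P) (hy : y ∈ R) (hx0 : x ≠ 0) (hy0 : y ≠ 0) : LinearIndependent K ![x, y] := by
  rw [LinearIndependent.pair_iff]
  intro s t hst
  have h1 : s • x ∈ P ⊓ R := by
    refine ⟨P.smul_mem _ hx, ?_⟩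
    rw [eq_neg_of_add_eq_zero_left hst]
    exact R.neg_mem (R.smul_mem _ hy)
  rw [h, mem_bot] at h1
  rw [h1, zero_add] at hst
  exact ⟨(smul_eq_zero.1 h1).resolve_right hx0, (smul_eq_zero.1 hst).resolve_right hy0⟩

theorem exists_ne_zero_of_finrank_pos {P : Submodule K W} (h : 0 < finrank K P) :
    ∃ x ∈ P, x ≠ 0 :=
  exists_mem_ne_zero_of_ne_bot (by rintro rfl; simp at h)

theorem exists_typeA {n : ℕ} (e : Fin (n + 1) ≃ Projectivization K (Fin 2 → K))
    {U V : Fin (n + 1) → Submodule K W} (hW : finrank K W = 2) {i : Fin (n + 1)}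
    (hi : V i = ⊥) (hV : ∀ k, k ≠ i → V k = ⊤) (hU : Function.Injective U)
    (hU1 : ∀ j, finrank K (U j) = 1) :
    ∃ U' V', TupleEquiv U U' ∧ TupleEquiv V V' ∧ IsTypeA e U' V' := by
  have : FiniteDimensional K W := FiniteDimensional.of_finrank_pos (by omega)
  let B := finBasisOfFinrankEq K W hW
  have hB : LinearIndependent K ![B 0, B 1] := by
    convert B.linearIndependent
    ext j
    fin_cases j <;> rfl
  have hspan : span K {B 0, B 1} = ⊤ :=
    (eq_span_pair_of_finrank_eq_two (finrank_top K W ▸ hW) mem_top mem_top hB).symm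
  refine ⟨fun k => ⊥ ⊔ span K {(e k).rep 0 • B 0 + (e k).rep 1 • B 1},
    -- The swap moves the zero space to the last index, where Type A expects `S`.
    V ∘ Equiv.swap (Fin.last n) i, ?_, ⟨Equiv.swap (Fin.last n) i, fun _ => rfl⟩,
    ⊥, B 0, B 1, hB, bot_inf_eq _, ?_, ?_, fun _ => rfl⟩
  · refine tupleEquiv_of_injective hU fun j => ?_
    obtain ⟨x, hx, hx0⟩ := exists_ne_zero_of_finrank_pos (by rw [hU1 j]; exact one_pos)
    have hx' : x ∈ span K {B 0, B 1} := hspan ▸ mem_top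
    obtain ⟨α, β, rfl⟩ := mem_span_pair.1 hx'
    have hαβ : α ≠ 0 ∨ β ≠ 0 := by
      by_contra! h
      simp [h.1, h.2] at hx0
    obtain ⟨k, t, ht, h0, h1⟩ := exists_rep_eq_mul e hαβ
    refine ⟨k, ?_⟩
    have : (e k).rep 0 • B 0 + (e k).rep 1 • B 1 = t • (α • B 0 + β • B 1) := by
      rw [h0, h1, smul_add, smul_smul, smul_smul]
    simp only [bot_sup_eq]
    rw [this]
    exact eq_span_singleton_of_finrank_eq_one (hU1 j) (smul_mem _ _ hx) (smul_ne_zero ht hx0)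
  · intro k
    rw [bot_sup_eq, hspan]
    refine hV _ fun h => ?_
    have h2 := (Equiv.swap (Fin.last n) i).injective (h.trans (Equiv.swap_apply_left _ _).symm)
    exact (Fin.castSucc_lt_last k).ne h2
  · simp [hi]

/-- Since `a ∉ P`, the plane is not ⟨a, b⟩ and has a vector with nonzero c-coordinate; scale that
coordinate to 1 and subtract the multiple of `b`. -/
theorem exists_eq_span_of_mem_of_notMem {P : Submodule K W} (hP : finrank K P = 2) {a b c : W}
    (habc : LinearIndependent K ![a, b, c]) (hspan : span K {a, b, c} = ⊤) (hb : b ∈ P)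
    (ha : a ∉ P) : ∃ r : K, P = span K {b, r • a + c} := by
  have hab : LinearIndependent K ![a, b] := by
    have := habc.comp ![0, 1] (by decide)
    convert this
    ext j
    fin_cases j <;> rfl
  obtain ⟨x, hx, hxab⟩ : ∃ x ∈ P, x ∉ span K {a, b} := by
    rw [← SetLike.not_le_iff_exists]
    intro hle
    have h2 := finrank_span_eq_card hab
    rw [Matrix.range_cons_cons_empty, Fintype.card_fin] at h2
    have : FiniteDimensional K (span K {a, b}) := FiniteDimensional.of_finrank_pos (by omega)
    have := eq_of_le_of_finrank_le hle (by rw [h2, hP])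
    exact ha (this ▸ subset_span (by simp))
  have hx' : x ∈ span K {a, b, c} := hspan ▸ mem_top
  obtain ⟨s, t, u, rfl⟩ := mem_span_triple.1 hx'
  have hu : u ≠ 0 := by
    rintro rfl
    exact hxab (mem_span_pair.2 ⟨s, t, by simp⟩)
  have hmem : (u⁻¹ * s) • a + c ∈ P := by
    have h1 := P.sub_mem (P.smul_mem u⁻¹ hx) (P.smul_mem (u⁻¹ * t) hb)
    have h2 : u⁻¹ • (s • a + t • b + u • c) - (u⁻¹ * t) • b = (u⁻¹ * s) • a + c := by
      rw [smul_add, smul_add, smul_smul, smul_smul, smul_smul, inv_mul_cancel₀ hu, one_smul]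
      abel
    rwa [h2] at h1
  refine ⟨u⁻¹ * s, eq_span_pair_of_finrank_eq_two hP hb hmem ?_⟩
  rw [LinearIndependent.pair_iff]
  intro p r hpr
  rw [Fintype.linearIndependent_iff] at habc
  have h1 := habc ![r * (u⁻¹ * s), p, r] (by
    simp only [Fin.sum_univ_three, Matrix.cons_val]
    rw [← hpr, smul_add, smul_smul]
    abel)
  exact ⟨h1 1, h1 2⟩

theorem exists_tupleEquiv_planes {n : ℕ} (f : Fin n ≃ K) {V : Fin (n + 1) → Submodule K W}
    {i : Fin (n + 1)} {a b c : W} (habc : LinearIndependent K ![a, b, c])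
    (hspan : span K {a, b, c} = ⊤) (hi : V i = span K {a})
    (hV : ∀ k, k ≠ i → finrank K (V k) = 2 ∧ b ∈ V k ∧ a ∉ V k ∧ ∀ l, V k = V l → k = l) :
    ∃ V', TupleEquiv V V' ∧ V' (Fin.last n) = ⊥ ⊔ span K {a} ∧
      ∀ k : Fin n, V' k.castSucc = ⊥ ⊔ span K {b, f k • a + c} := by
  refine ⟨Fin.lastCases (⊥ ⊔ span K {a}) fun k => ⊥ ⊔ span K {b, f k • a + c},
    tupleEquiv_of_injective ?_ fun k => ?_, by simp, by simp⟩
  · intro k l hkl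
    by_cases hk : k = i
    · by_cases hl : l = i
      · rw [hk, hl]
      · exact ((hV l hl).2.2.2 k hkl.symm).symm
    · exact (hV k hk).2.2.2 l hkl
  · by_cases hk : k = i
    · exact ⟨Fin.last n, by simp [hk, hi]⟩
    · obtain ⟨h1, h2, h3, -⟩ := hV k hk
      obtain ⟨r, hr⟩ := exists_eq_span_of_mem_of_notMem h1 habc hspan h2 h3
      exact ⟨(f.symm r).castSucc, by simp [hr]⟩

/-- `a` and `b` span the lines `V i` and `U j`, and `c` is any vector outside ⟨a, b⟩. The planes of
the two tuples are parametrised by one lemma, applied a second time with `a` and `b` exchanged. -/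
theorem exists_typeB {n : ℕ} (f : Fin n ≃ K) {U V : Fin (n + 1) → Submodule K W}
    (hW : finrank K W = 3) {i j : Fin (n + 1)} (hi : finrank K (V i) = 1)
    (hj : finrank K (U j) = 1) (hne : V i ≠ U j)
    (hV : ∀ k, k ≠ i → finrank K (V k) = 2 ∧ U j ≤ V k ∧ ¬ V i ≤ V k ∧ ∀ l, V k = V l → k = l)
    (hU : ∀ k, k ≠ j → finrank K (U k) = 2 ∧ V i ≤ U k ∧ ¬ U j ≤ U k ∧
      ∀ l, U k = U l → k = l) :
    ∃ U' V', TupleEquiv U U' ∧ TupleEquiv V V' ∧ IsTypeB f U' V' := by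
  have : FiniteDimensional K W := FiniteDimensional.of_finrank_pos (by omega)
  obtain ⟨a, ha, ha0⟩ := exists_ne_zero_of_finrank_pos (by rw [hi]; exact one_pos)
  obtain ⟨b, hb, hb0⟩ := exists_ne_zero_of_finrank_pos (by rw [hj]; exact one_pos)
  have hVi := eq_span_singleton_of_finrank_eq_one hi ha ha0
  have hUj := eq_span_singleton_of_finrank_eq_one hj hb hb0
  have hinf : V i ⊓ U j = ⊥ := by
    by_contra hbot
    have h1 : 0 < finrank K (V i ⊓ U j : Submodule K W) :=
      Nat.pos_of_ne_zero fun h => hbot (finrank_eq_zero.1 h)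
    have h2 := eq_of_le_of_finrank_le (inf_le_left : V i ⊓ U j ≤ V i) (by omega)
    have h3 := eq_of_le_of_finrank_le (inf_le_right : V i ⊓ U j ≤ U j) (by omega)
    exact hne (h2.symm.trans h3)
  have hab := linearIndependent_pair_of_inf_eq_bot hinf ha hb ha0 hb0
  have hab2 := finrank_span_eq_card hab
  rw [Matrix.range_cons_cons_empty, Fintype.card_fin] at hab2
  obtain ⟨c, -, hc⟩ : ∃ c ∈ (⊤ : Submodule K W), c ∉ span K {a, b} := by
    rw [← SetLike.not_le_iff_exists, top_le_iff]
    intro h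
    rw [h, finrank_top, hW] at hab2
    omega
  have habc : LinearIndependent K ![a, b, c] := by
    rw [Fintype.linearIndependent_iff]
    intro g hg
    simp only [Fin.sum_univ_three, Matrix.cons_val] at hg
    have h2 : g 2 = 0 := by
      by_contra h2
      refine hc (((span K {a, b}).smul_mem_iff h2).1 ?_)
      rw [eq_neg_of_add_eq_zero_right hg]
      exact neg_mem (mem_span_pair.2 ⟨_, _, rfl⟩)
    rw [h2, zero_smul, add_zero] at hg
    have := LinearIndependent.pair_iff.1 hab _ _ hg
    intro j
    fin_cases j
    exacts [this.1, this.2, h2]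
  have hbac : LinearIndependent K ![b, a, c] := by
    have := habc.comp ![1, 0, 2] (by decide)
    convert this
    ext j
    fin_cases j <;> rfl
  have hrange : ∀ x y z : W, Set.range ![x, y, z] = {x, y, z} := by
    intro x y z
    rw [Matrix.range_cons, Matrix.range_cons_cons_empty, Set.singleton_union]
  have hspan : span K {a, b, c} = ⊤ := by
    rw [← hrange]
    exact habc.span_eq_top_of_card_eq_finrank' (by rw [hW, Fintype.card_fin])
  have hspan' : span K {b, a, c} = ⊤ := by rw [Set.insert_comm, hspan]
  obtain ⟨V', h1, h2, h3⟩ := exists_tupleEquiv_planes f habc hspan hVi fun k hk => by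
    have := hV k hk
    rwa [hUj, hVi, span_singleton_le_iff_mem, span_singleton_le_iff_mem] at this
  obtain ⟨U', h4, h5, h6⟩ := exists_tupleEquiv_planes f hbac hspan' hUj fun k hk => by
    have := hU k hk
    rwa [hUj, hVi, span_singleton_le_iff_mem, span_singleton_le_iff_mem] at this
  exact ⟨U', V', h4, h1, ⊥, a, b, c, habc, bot_inf_eq _, h2, h3, h5, h6⟩

theorem exists_smul_add_smul_mem {R P : Submodule K W} (h : 0 < finrank K (R ⊓ P : Submodule K W))
    {x y : W} (hP : P = span K {x, y}) : ∃ α β : K, (α ≠ 0 ∨ β ≠ 0) ∧ α • x + β • y ∈ R := by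
  obtain ⟨z, ⟨hzR, hzP⟩, hz0⟩ := exists_ne_zero_of_finrank_pos h
  rw [hP] at hzP
  obtain ⟨α, β, rfl⟩ := mem_span_pair.1 hzP
  refine ⟨α, β, ?_, hzR⟩
  by_contra! h
  simp [h.1, h.2] at hz0

theorem linearIndependent_four {a b c d : W} (h : ∀ s t u v : K,
    s • a + t • b + u • c + v • d = 0 → s = 0 ∧ t = 0 ∧ u = 0 ∧ v = 0) :
    LinearIndependent K ![a, b, c, d] := by
  rw [Fintype.linearIndependent_iff]
  intro g hg
  simp only [Fin.sum_univ_four, Matrix.cons_val] at hg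
  obtain ⟨h0, h1, h2, h3⟩ := h _ _ _ _ hg
  intro j
  fin_cases j
  exacts [h0, h1, h2, h3]

theorem four_eq_zero {a b c d : W} (h : LinearIndependent K ![a, b, c, d]) {s t u v : K}
    (hs : s • a + t • b + u • c + v • d = 0) : s = 0 ∧ t = 0 ∧ u = 0 ∧ v = 0 := by
  have := Fintype.linearIndependent_iff.1 h ![s, t, u, v]
    (by simpa only [Fin.sum_univ_four, Matrix.cons_val] using hs)
  exact ⟨this 0, this 1, this 2, this 3⟩

/-- A plane that meets `⟨a, b⟩`, `⟨c, d⟩` and `⟨a + c, b + d⟩` meets the first two in corresponding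
points. -/
theorem smul_add_smul_mem_of_meets {R : Submodule K W} (hR : finrank K R = 2) {a b c d : W}
    (hli : LinearIndependent K ![a, b, c, d]) {α β γ δ μ ν : K} (hαβ : α ≠ 0 ∨ β ≠ 0)
    (h1 : α • a + β • b ∈ R) (hγδ : γ ≠ 0 ∨ δ ≠ 0) (h2 : γ • c + δ • d ∈ R)
    (hμν : μ ≠ 0 ∨ ν ≠ 0) (h3 : μ • (a + c) + ν • (b + d) ∈ R) : α • c + β • d ∈ R := by
  have hxy : LinearIndependent K ![α • a + β • b, γ • c + δ • d] := by
    rw [LinearIndependent.pair_iff]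
    intro s t hst
    obtain ⟨e1, e2, e3, e4⟩ := four_eq_zero hli (s := s * α) (t := s * β) (u := t * γ)
      (v := t * δ) (by rw [← hst]; module)
    constructor
    · rcases hαβ with h | h
      exacts [(mul_eq_zero.1 e1).resolve_right h, (mul_eq_zero.1 e2).resolve_right h]
    · rcases hγδ with h | h
      exacts [(mul_eq_zero.1 e3).resolve_right h, (mul_eq_zero.1 e4).resolve_right h]
  have h4 := h3
  rw [eq_span_pair_of_finrank_eq_two hR h1 h2 hxy, mem_span_pair] at h4
  obtain ⟨r, s, hrs⟩ := h4
  -- Comparing coordinates gives r(α, β) = (μ, ν) = s(γ, δ), so the three points have the same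
  -- parameter.
  obtain ⟨e1, e2, e3, e4⟩ := four_eq_zero hli (s := r * α - μ) (t := r * β - ν)
    (u := s * γ - μ) (v := s * δ - ν) (by
      rw [← sub_eq_zero] at hrs
      rw [← hrs]
      module)
  rw [sub_eq_zero] at e1 e2 e3 e4
  have hr : r ≠ 0 := by
    rintro rfl
    rw [zero_mul] at e1 e2
    rcases hμν with h | h
    exacts [h e1.symm, h e2.symm]
  have h5 : r • (α • c + β • d) = s • (γ • c + δ • d) := by
    rw [smul_add, smul_add, smul_smul, smul_smul, smul_smul, smul_smul, e1, e2, e3, e4]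
  rw [← R.smul_mem_iff hr, h5]
  exact R.smul_mem s h2

theorem exists_eq_span_rep {n : ℕ} (e : Fin n ≃ Projectivization K (Fin 2 → K))
    {R : Submodule K W} (hR : finrank K R = 2) {a b c d : W}
    (hli : LinearIndependent K ![a, b, c, d]) {P₁ P₂ P₃ : Submodule K W}
    (hP₁ : P₁ = span K {a, b}) (hP₂ : P₂ = span K {c, d}) (hP₃ : P₃ = span K {a + c, b + d})
    (h₁ : 0 < finrank K (R ⊓ P₁ : Submodule K W)) (h₂ : 0 < finrank K (R ⊓ P₂ : Submodule K W))
    (h₃ : 0 < finrank K (R ⊓ P₃ : Submodule K W)) :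
    ∃ k, R = span K
      {(e k).rep 0 • a + (e k).rep 1 • b, (e k).rep 0 • c + (e k).rep 1 • d} := by
  obtain ⟨α, β, hαβ, h1⟩ := exists_smul_add_smul_mem h₁ hP₁
  obtain ⟨γ, δ, hγδ, h2⟩ := exists_smul_add_smul_mem h₂ hP₂
  obtain ⟨μ, ν, hμν, h3⟩ := exists_smul_add_smul_mem h₃ hP₃
  have h4 := smul_add_smul_mem_of_meets hR hli hαβ h1 hγδ h2 hμν h3
  obtain ⟨k, r, hr, e0, e1⟩ := exists_rep_eq_mul e hαβ
  refine ⟨k, eq_span_pair_of_finrank_eq_two hR ?_ ?_ ?_⟩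
  · rw [e0, e1, mul_smul, mul_smul, ← smul_add]
    exact R.smul_mem r h1
  · rw [e0, e1, mul_smul, mul_smul, ← smul_add]
    exact R.smul_mem r h4
  · rw [LinearIndependent.pair_iff]
    intro s t hst
    obtain ⟨f1, f2, f3, f4⟩ := four_eq_zero hli (s := s * (e k).rep 0) (t := s * (e k).rep 1)
      (u := t * (e k).rep 0) (v := t * (e k).rep 1) (by rw [← hst]; module)
    have hrep : (e k).rep 0 ≠ 0 ∨ (e k).rep 1 ≠ 0 := by
      rw [e0, e1]
      exact hαβ.imp (mul_ne_zero hr) (mul_ne_zero hr)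
    rcases hrep with h | h
    · exact ⟨(mul_eq_zero.1 f1).resolve_right h, (mul_eq_zero.1 f3).resolve_right h⟩
    · exact ⟨(mul_eq_zero.1 f2).resolve_right h, (mul_eq_zero.1 f4).resolve_right h⟩

/-- In a plane spanned by `x` and `y`, a line different from `⟨x⟩` and `⟨y⟩` is spanned by some
`x + r • y` with `r ≠ 0`. -/
theorem exists_add_smul_mem {R P Q T : Submodule K W} (hPR : P ⊓ R = ⊥) (hQR : Q ⊓ R = ⊥)
    (h : 0 < finrank K (R ⊓ T : Submodule K W)) {x y : W} (hT : T = span K {x, y}) (hx : x ∈ P)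
    (hy : y ∈ Q) : ∃ r : K, r ≠ 0 ∧ x + r • y ∈ R := by
  obtain ⟨z, ⟨hzR, hzP⟩, hz0⟩ := exists_ne_zero_of_finrank_pos h
  rw [hT] at hzP
  obtain ⟨s, t, rfl⟩ := mem_span_pair.1 hzP
  have hs : s ≠ 0 := by
    rintro rfl
    rw [zero_smul, zero_add] at hzR hz0
    have : t • y ∈ Q ⊓ R := ⟨Q.smul_mem _ hy, hzR⟩
    rw [hQR] at this
    exact hz0 this
  have ht : t ≠ 0 := by
    rintro rfl
    rw [zero_smul, add_zero] at hzR hz0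
    have : s • x ∈ P ⊓ R := ⟨P.smul_mem _ hx, hzR⟩
    rw [hPR] at this
    exact hz0 this
  refine ⟨s⁻¹ * t, mul_ne_zero (inv_ne_zero hs) ht, ?_⟩
  rw [← R.smul_mem_iff hs, smul_add, smul_smul, mul_inv_cancel_left₀ hs]
  exact hzR

/-- Three members of one family determine the opposite regulus: once the basis is adapted to them,
every plane meeting all three has the required form (`exists_eq_span_rep`). The basis vectors span
the intersections of two members of V with two of U, and a third member of each fixes their scaling.
-/
theorem exists_typeC {n : ℕ} (hn : 1 < n) (e : Fin (n + 1) ≃ Projectivization K (Fin 2 → K))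
    {U V : Fin (n + 1) → Submodule K W}
    (hU : ∀ i, finrank K (U i) = 2) (hV : ∀ i, finrank K (V i) = 2)
    (hUU : ∀ i j, i ≠ j → U i ⊓ U j = ⊥) (hVV : ∀ i j, i ≠ j → V i ⊓ V j = ⊥)
    (hUV : ∀ i j, 0 < finrank K (U i ⊓ V j : Submodule K W)) :
    ∃ U' V', TupleEquiv U U' ∧ TupleEquiv V V' ∧ IsTypeC e U' V' := by
  obtain ⟨i, j, k, hij, hik, hjk⟩ := Fintype.two_lt_card_iff.1
    (by rw [Fintype.card_fin]; omega : 2 < Fintype.card (Fin (n + 1)))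
  have hVU : ∀ i j, 0 < finrank K (V i ⊓ U j : Submodule K W) := fun i j => by
    rw [inf_comm]; exact hUV j i
  have hinj : ∀ {T : Fin (n + 1) → Submodule K W}, (∀ i, finrank K (T i) = 2) →
      (∀ i j, i ≠ j → T i ⊓ T j = ⊥) → Function.Injective T := by
    intro T hT hTT i j h
    by_contra hne
    have h1 := hTT i j hne
    rw [← h, inf_idem] at h1
    have h2 := hT i
    rw [h1, finrank_bot] at h2
    omega
  obtain ⟨a, ⟨haV, haU⟩, ha0⟩ := exists_ne_zero_of_finrank_pos (hVU i i)
  obtain ⟨b, ⟨hbV, hbU⟩, hb0⟩ := exists_ne_zero_of_finrank_pos (hVU i j)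
  obtain ⟨c, ⟨hcV, hcU⟩, hc0⟩ := exists_ne_zero_of_finrank_pos (hVU j i)
  obtain ⟨d, ⟨hdV, hdU⟩, hd0⟩ := exists_ne_zero_of_finrank_pos (hVU j j)
  have hpair : ∀ {P R T : Submodule K W} {x y : W}, P ⊓ R = ⊥ → finrank K T = 2 → x ∈ P → y ∈ R →
      x ∈ T → y ∈ T → x ≠ 0 → y ≠ 0 → T = span K {x, y} :=
    fun h hT hx hy hxT hyT hx0 hy0 => eq_span_pair_of_finrank_eq_two hT hxT hyT
      (linearIndependent_pair_of_inf_eq_bot h hx hy hx0 hy0)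
  obtain ⟨r, hr, hacr⟩ := exists_add_smul_mem (hVV i k hik) (hVV j k hjk) (hVU k i)
    (hpair (hVV i j hij) (hU i) haV hcV haU hcU ha0 hc0) haV hcV
  obtain ⟨s, hs, hbds⟩ := exists_add_smul_mem (hVV i k hik) (hVV j k hjk) (hVU k j)
    (hpair (hVV i j hij) (hU j) hbV hdV hbU hdU hb0 hd0) hbV hdV
  obtain ⟨t, ht, habt⟩ := exists_add_smul_mem (hUU i k hik) (hUU j k hjk) (hUV k i)
    (hpair (hUU i j hij) (hV i) haU hbU haV hbV ha0 hb0) haU hbU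
  -- Rescaling puts a + c' and b' + d' into `V k` and a + b' into `U k`.
  obtain ⟨b', rfl⟩ : ∃ b', b = t⁻¹ • b' := ⟨t • b, by rw [inv_smul_smul₀ ht]⟩
  obtain ⟨c', rfl⟩ : ∃ c', c = r⁻¹ • c' := ⟨r • c, by rw [inv_smul_smul₀ hr]⟩
  obtain ⟨d', rfl⟩ : ∃ d', d = s⁻¹ • t⁻¹ • d' :=
    ⟨t • s • d, by rw [inv_smul_smul₀ ht, inv_smul_smul₀ hs]⟩
  rw [smul_inv_smul₀ hr] at hacr
  rw [smul_inv_smul₀ ht] at habt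
  rw [smul_inv_smul₀ hs, ← smul_add, (V k).smul_mem_iff (inv_ne_zero ht)] at hbds
  have ht' := inv_ne_zero ht
  have hs' := inv_ne_zero hs
  have hr' := inv_ne_zero hr
  replace hbV : b' ∈ V i := ((V i).smul_mem_iff ht').1 hbV
  replace hbU : b' ∈ U j := ((U j).smul_mem_iff ht').1 hbU
  replace hcV : c' ∈ V j := ((V j).smul_mem_iff hr').1 hcV
  replace hcU : c' ∈ U i := ((U i).smul_mem_iff hr').1 hcU
  replace hdV : d' ∈ V j := ((V j).smul_mem_iff ht').1 (((V j).smul_mem_iff hs').1 hdV)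
  replace hdU : d' ∈ U j := ((U j).smul_mem_iff ht').1 (((U j).smul_mem_iff hs').1 hdU)
  replace hb0 : b' ≠ 0 := fun h => hb0 (by rw [h, smul_zero])
  replace hc0 : c' ≠ 0 := fun h => hc0 (by rw [h, smul_zero])
  replace hd0 : d' ≠ 0 := fun h => hd0 (by rw [h, smul_zero, smul_zero])
  have hVi := hpair (hUU i j hij) (hV i) haU hbU haV hbV ha0 hb0
  have hVj := hpair (hUU i j hij) (hV j) hcU hdU hcV hdV hc0 hd0
  have hUi := hpair (hVV i j hij) (hU i) haV hcV haU hcU ha0 hc0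
  have hUj := hpair (hVV i j hij) (hU j) hbV hdV hbU hdU hb0 hd0
  have hli : LinearIndependent K ![a, b', c', d'] := by
    refine linearIndependent_four fun p q u v h => ?_
    have h1 : p • a + q • b' ∈ V i ⊓ V j := by
      refine ⟨add_mem (smul_mem _ _ haV) (smul_mem _ _ hbV), ?_⟩
      rw [add_assoc] at h
      rw [eq_neg_of_add_eq_zero_left h]
      exact neg_mem (add_mem (smul_mem _ _ hcV) (smul_mem _ _ hdV))
    rw [hVV i j hij, mem_bot] at h1
    rw [h1, zero_add] at h
    obtain ⟨h2, h3⟩ := LinearIndependent.pair_iff.1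
      (linearIndependent_pair_of_inf_eq_bot (hUU i j hij) haU hbU ha0 hb0) _ _ h1
    obtain ⟨h4, h5⟩ := LinearIndependent.pair_iff.1
      (linearIndependent_pair_of_inf_eq_bot (hUU i j hij) hcU hdU hc0 hd0) _ _ h
    exact ⟨h2, h3, h4, h5⟩
  have hli' : LinearIndependent K ![a, c', b', d'] := by
    refine linearIndependent_four fun p q u v h => ?_
    obtain ⟨h1, h2, h3, h4⟩ := four_eq_zero hli (s := p) (t := u) (u := q) (v := v)
      (by rw [← h]; abel)
    exact ⟨h1, h3, h2, h4⟩
  have hVk : V k = span K {a + c', b' + d'} := by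
    refine eq_span_pair_of_finrank_eq_two (hV k) hacr hbds ?_
    rw [LinearIndependent.pair_iff]
    intro p q h
    obtain ⟨h1, h2, -, -⟩ := four_eq_zero hli (s := p) (t := q) (u := p) (v := q)
      (by rw [← h]; module)
    exact ⟨h1, h2⟩
  -- No scaling freedom is left for this membership: it is forced, because `U k` meets `V i` in a +
  -- b' and also meets `V j` and `V k`.
  have hcdU : c' + d' ∈ U k := by
    obtain ⟨γ, δ, hγδ, h2⟩ := exists_smul_add_smul_mem (hUV k j) hVj
    obtain ⟨μ, ν, hμν, h3⟩ := exists_smul_add_smul_mem (hUV k k) hVk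
    simpa using smul_add_smul_mem_of_meets (hU k) hli (α := 1) (β := 1) (Or.inl one_ne_zero)
      (by simpa using habt) hγδ h2 hμν h3
  have hUk : U k = span K {a + b', c' + d'} := by
    refine eq_span_pair_of_finrank_eq_two (hU k) habt hcdU ?_
    rw [LinearIndependent.pair_iff]
    intro p q h
    obtain ⟨h1, -, h2, -⟩ := four_eq_zero hli (s := p) (t := p) (u := q) (v := q)
      (by rw [← h]; module)
    exact ⟨h1, h2⟩
  refine ⟨_, _, ?_, ?_, ⊥, a, c', b', d', hli', bot_inf_eq _, fun _ => rfl, fun _ => rfl⟩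
  · refine tupleEquiv_of_injective (hinj hU hUU) fun l => ?_
    simp only [bot_sup_eq]
    exact exists_eq_span_rep e (hU l) hli hVi hVj hVk (hUV l i) (hUV l j) (hUV l k)
  · refine tupleEquiv_of_injective (hinj hV hVV) fun l => ?_
    simp only [bot_sup_eq]
    exact exists_eq_span_rep e (hV l) hli' hUi hUj hUk (hVU l i) (hVU l j) (hVU l k)

end Coordinates

/-! ### Reduction to trivial intersection and full span -/

section Reduction

variable {K : Type*} [Field K] {W : Type*} [AddCommGroup W] [Module K W]

theorem TupleEquiv.symm {m : ℕ} {U V : Fin m → Submodule K W} (h : TupleEquiv U V) :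
    TupleEquiv V U := by
  obtain ⟨π, hπ⟩ := h
  exact ⟨π.symm, fun i => by rw [hπ, Equiv.apply_symm_apply]⟩

/-- The pair `(U, V)` is equivalent to a pair of one of the three types. -/
def IsEquivToType {q : ℕ} (e : Fin (q + 1) ≃ Projectivization K (Fin 2 → K)) (f : Fin q ≃ K)
    (U V : Fin (q + 1) → Submodule K W) : Prop :=
  ∃ U' V' : Fin (q + 1) → Submodule K W,
    PairEquiv U V U' V' ∧ (IsTypeA e U' V' ∨ IsTypeB f U' V' ∨ IsTypeC e U' V')

theorem IsEquivToType.symm {q : ℕ} {e : Fin (q + 1) ≃ Projectivization K (Fin 2 → K)}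
    {f : Fin q ≃ K} {U V : Fin (q + 1) → Submodule K W} (h : IsEquivToType e f U V) :
    IsEquivToType e f V U := by
  obtain ⟨U', V', h1, h2⟩ := h
  exact ⟨U', V', Or.symm h1, h2⟩

section Lift

variable {Q : Type*} [AddCommGroup Q] [Module K Q] {S₀ : Submodule K W} {σ : Q →ₗ[K] W}

theorem sup_map_inf_map_eq_bot (hσ : Function.Injective σ) (h : S₀ ⊓ LinearMap.range σ = ⊥)
    {S T : Submodule K Q} (hST : S ⊓ T = ⊥) : (S₀ ⊔ S.map σ) ⊓ T.map σ = ⊥ := by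
  rw [eq_bot_iff]
  rintro _ ⟨hx, y, hy, rfl⟩
  obtain ⟨s, hs, _, ⟨x, hx, rfl⟩, hsx⟩ := mem_sup.1 hx
  have h1 : s ∈ S₀ ⊓ LinearMap.range σ :=
    ⟨hs, y - x, by rw [map_sub, ← hsx, add_sub_cancel_right]⟩
  rw [h, mem_bot] at h1
  rw [h1, zero_add] at hsx
  have h2 : y ∈ S ⊓ T := ⟨hσ hsx ▸ hx, hy⟩
  rw [hST, mem_bot] at h2
  simp [h2]

/-- All three types allow an arbitrary `S`, so a common summand independent of the image of `σ` is
absorbed into it. -/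
theorem IsEquivToType.lift {q : ℕ} {e : Fin (q + 1) ≃ Projectivization K (Fin 2 → K)}
    {f : Fin q ≃ K} {U V : Fin (q + 1) → Submodule K Q} (h : IsEquivToType e f U V)
    (hσ : Function.Injective σ) (hS : S₀ ⊓ LinearMap.range σ = ⊥) :
    IsEquivToType e f (fun i => S₀ ⊔ (U i).map σ) (fun i => S₀ ⊔ (V i).map σ) := by
  have hequiv : ∀ {U V : Fin (q + 1) → Submodule K Q}, TupleEquiv U V →
      TupleEquiv (fun i => S₀ ⊔ (U i).map σ) (fun i => S₀ ⊔ (V i).map σ) := by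
    rintro U V ⟨π, hπ⟩
    exact ⟨π, fun i => by simp only [hπ i]⟩
  have hker : LinearMap.ker σ = ⊥ := LinearMap.ker_eq_bot.2 hσ
  obtain ⟨U', V', h1, h2⟩ := h
  refine ⟨fun i => S₀ ⊔ (U' i).map σ, fun i => S₀ ⊔ (V' i).map σ,
    h1.imp (fun h => ⟨hequiv h.1, hequiv h.2⟩) (fun h => ⟨hequiv h.1, hequiv h.2⟩), ?_⟩
  rcases h2 with ⟨S, a, b, hli, hdis, hV, hVl, hU⟩ | ⟨S, a, b, c, hli, hdis, hVl, hV, hUl, hU⟩ |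
    ⟨S, a, b, c, d, hli, hdis, hV, hU⟩
  · refine Or.inl ⟨S₀ ⊔ S.map σ, σ a, σ b, ?_, ?_, fun i => ?_, ?_, fun i => ?_⟩
    · have hcomp : σ ∘ ![a, b] = ![σ a, σ b] := by
        ext j
        fin_cases j <;> rfl
      exact hcomp ▸ hli.map' σ hker
    · convert sup_map_inf_map_eq_bot hσ hS hdis
      simp [map_span, Set.image_insert_eq]
    · simp [hV, Submodule.map_sup, map_span, Set.image_insert_eq, sup_assoc]
    · simp [hVl]
    · simp [hU, Submodule.map_sup, map_span, sup_assoc]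
  · refine Or.inr (Or.inl ⟨S₀ ⊔ S.map σ, σ a, σ b, σ c, ?_, ?_, ?_, fun i => ?_, ?_, fun i => ?_⟩)
    · have hcomp : σ ∘ ![a, b, c] = ![σ a, σ b, σ c] := by
        ext j
        fin_cases j <;> rfl
      exact hcomp ▸ hli.map' σ hker
    · convert sup_map_inf_map_eq_bot hσ hS hdis
      simp [map_span, Set.image_insert_eq]
    · simp [hVl, Submodule.map_sup, map_span, sup_assoc]
    · simp [hV, Submodule.map_sup, map_span, Set.image_insert_eq, sup_assoc]
    · simp [hUl, Submodule.map_sup, map_span, sup_assoc]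
    · simp [hU, Submodule.map_sup, map_span, Set.image_insert_eq, sup_assoc]
  · refine Or.inr (Or.inr ⟨S₀ ⊔ S.map σ, σ a, σ b, σ c, σ d, ?_, ?_, fun i => ?_, fun i => ?_⟩)
    · have hcomp : σ ∘ ![a, b, c, d] = ![σ a, σ b, σ c, σ d] := by
        ext j
        fin_cases j <;> rfl
      exact hcomp ▸ hli.map' σ hker
    · convert sup_map_inf_map_eq_bot hσ hS hdis
      simp [map_span, Set.image_insert_eq]
    · simp [hV, Submodule.map_sup, map_span, Set.image_insert_eq, sup_assoc]
    · simp [hU, Submodule.map_sup, map_span, Set.image_insert_eq, sup_assoc]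

end Lift

/-! ### Passage to annihilators and the case distinction -/

section Dual

variable [Finite K] [FiniteDimensional K W]
  (e : Fin (Nat.card K + 1) ≃ Projectivization K (Fin 2 → K)) (f : Fin (Nat.card K) ≃ K)
  {U V : Fin (Nat.card K + 1) → Submodule K W}

theorem isEquivToType_of_max
    (h : SameMultiplicity (fun i => (V i).dualAnnihilator) (fun i => (U i).dualAnnihilator))
    (hUV : ¬ TupleEquiv U V) (hbot : ∀ x, (∀ i, x ∈ V i) → (∀ i, x ∈ U i) → x = 0)
    (htop : ∀ T, (∀ i, V i ≤ T) → (∀ i, U i ≤ T) → T = ⊤) {i : Fin (Nat.card K + 1)}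
    (hmaxV : ∀ k, finrank K (V k).dualAnnihilator ≤ finrank K (V i).dualAnnihilator)
    (hmaxU : ∀ k, finrank K (U k).dualAnnihilator ≤ finrank K (V i).dualAnnihilator) :
    IsEquivToType e f U V := by
  have hq : 1 < Nat.card K := Finite.one_lt_card
  have hι : Fintype.card (Fin (Nat.card K + 1)) = Nat.card K + 1 := Fintype.card_fin _
  have hd : ∀ i j, (V i).dualAnnihilator ≠ (U j).dualAnnihilator := by
    intro i j hij
    obtain ⟨π, hπ⟩ := h.exists_perm_of_common hι hij
    exact hUV ⟨π, fun k => Subspace.dualAnnihilator_inj.1 (hπ k)⟩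
  have hd' := fun i j => (hd j i).symm
  have hbotV : ∀ x, (∀ i, x ∈ (V i).dualAnnihilator) → x = 0 := by
    intro x hx
    have hx' := h.forall_mem hx
    simp only [mem_dualAnnihilator] at hx hx'
    -- The kernel of a functional in all annihilators contains every `V i` and `U i`, hence
    -- everything.
    exact LinearMap.ker_eq_top.1 (htop _ (fun i w hw => hx i w hw) fun i w hw => hx' i w hw)
  have hbotU : ∀ x, (∀ i, x ∈ (U i).dualAnnihilator) → x = 0 :=
    fun x hx => hbotV x (h.symm.forall_mem hx)
  have htopD : ∀ T, (∀ i, (V i).dualAnnihilator ≤ T) → (∀ i, (U i).dualAnnihilator ≤ T) →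
      T = ⊤ := by
    intro T hV hU
    have h1 : T.dualCoannihilator = ⊥ := by
      rw [eq_bot_iff]
      intro x hx
      refine hbot x (fun i => ?_) (fun i => ?_)
      · rw [← Subspace.dualAnnihilator_dualCoannihilator_eq (W := V i)]
        exact dualCoannihilator_anti (hV i) hx
      · rw [← Subspace.dualAnnihilator_dualCoannihilator_eq (W := U i)]
        exact dualCoannihilator_anti (hU i) hx
    rw [← Subspace.dualCoannihilator_dualAnnihilator_eq (W := T), h1, dualAnnihilator_bot]
  have hVr := fun i => Subspace.finrank_add_finrank_dualAnnihilator_eq (V i)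
  have hUr := fun i => Subspace.finrank_add_finrank_dualAnnihilator_eq (U i)
  have htwo := h.finrank_eq_two hι hd hbotU hmaxU
  by_cases hj : ∃ j, finrank K (U j).dualAnnihilator = 2
  · obtain ⟨j, hj⟩ := hj
    have hV2 : ∀ k, finrank K (V k).dualAnnihilator ≤ 2 := fun k => (hmaxV k).trans htwo.le
    have hU2 : ∀ k, finrank K (U k).dualAnnihilator ≤ 2 := fun k => (hmaxU k).trans htwo.le
    by_cases hall : (∀ k, finrank K (V k).dualAnnihilator = 2) ∧
        ∀ k, finrank K (U k).dualAnnihilator = 2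
    · obtain ⟨h4, hVV, hone⟩ := h.structure_of_forall_finrank_eq_two hι hd hbotU htopD
        hall.1 hall.2
      obtain ⟨-, hUU, -⟩ := h.symm.structure_of_forall_finrank_eq_two hι hd' hbotV
        (fun T h1 h2 => htopD T h2 h1) hall.2 hall.1
      rw [Subspace.dual_finrank_eq] at h4
      have hV2 : ∀ k, finrank K (V k) = 2 := fun k => by have := hVr k; rw [hall.1, h4] at this; omega
      have hU2 : ∀ k, finrank K (U k) = 2 := fun k => by have := hUr k; rw [hall.2, h4] at this; omega
      -- In dimension 4, the annihilator of P + R has dimension 4 - dim(P + R), which is dim(P ∩ R)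
      -- for planes.
      have key : ∀ {P R : Submodule K W}, finrank K P = 2 → finrank K R = 2 →
          finrank K (P ⊓ R : Submodule K W) =
            finrank K (P.dualAnnihilator ⊓ R.dualAnnihilator : Submodule K (Dual K W)) := by
        intro P R hP hR
        have h1 := Subspace.finrank_add_finrank_dualAnnihilator_eq (P ⊔ R)
        have h2 := finrank_sup_add_finrank_inf_eq P R
        rw [dualAnnihilator_sup_eq] at h1
        omega
      obtain ⟨U', V', hU', hV', hT⟩ := exists_typeC (U := U) (V := V) hq e hU2 hV2
        (fun i j hij => by
          rw [← finrank_eq_zero (R := K), key (hU2 i) (hU2 j), hUU i j hij, finrank_bot])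
        (fun i j hij => by
          rw [← finrank_eq_zero (R := K), key (hV2 i) (hV2 j), hVV i j hij, finrank_bot])
        (fun i j => by
          rw [key (hU2 i) (hV2 j), inf_comm, hone]; exact one_pos)
      exact ⟨U', V', Or.inl ⟨hU', hV'⟩, Or.inr (Or.inr hT)⟩
    · have hplanes : (∀ l, l ≠ i → finrank K (V l).dualAnnihilator < 2) ∧
          ∀ l, l ≠ j → finrank K (U l).dualAnnihilator < 2 := by
        by_cases hk : ∃ k, finrank K (V k).dualAnnihilator < 2
        · obtain ⟨k, hk⟩ := hk
          exact h.exists_unique_planes hι hd hV2 hU2 htwo hj hk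
        · push Not at hk
          obtain ⟨k, hk⟩ : ∃ k, finrank K (U k).dualAnnihilator < 2 := by
            by_contra! hk'
            exact hall ⟨fun k => le_antisymm (hV2 k) (hk k), fun k => le_antisymm (hU2 k) (hk' k)⟩
          exact (h.symm.exists_unique_planes hι hd' hU2 hV2 hj htwo hk).symm
      have h3 := h.finrank_eq_three hι hd htopD hV2 hU2 htwo hj hplanes.1 hplanes.2
      rw [Subspace.dual_finrank_eq] at h3
      obtain ⟨U', V', hU', hV', hT⟩ := exists_typeB (U := U) (V := V) f h3 (i := i) (j := j)
        (by have := hVr i; omega) (by have := hUr j; omega) (fun hij => hd i j (by rw [hij]))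
        (fun k hk => by
          obtain ⟨h1, h2, h5, h6⟩ := h.structure_of_unique_plane hι hd hV2 hj hplanes.1 hk
          refine ⟨by have := hVr k; omega, Subspace.dualAnnihilator_le_dualAnnihilator_iff.1 h2,
            fun hle => h5 (Subspace.dualAnnihilator_le_dualAnnihilator_iff.2 hle),
            fun l hl => h6 l (by rw [hl])⟩)
        (fun k hk => by
          obtain ⟨h1, h2, h5, h6⟩ := h.symm.structure_of_unique_plane hι hd' hU2 htwo
            hplanes.2 hk
          refine ⟨by have := hUr k; omega, Subspace.dualAnnihilator_le_dualAnnihilator_iff.1 h2,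
            fun hle => h5 (Subspace.dualAnnihilator_le_dualAnnihilator_iff.2 hle),
            fun l hl => h6 l (by rw [hl])⟩)
      exact ⟨U', V', Or.inl ⟨hU', hV'⟩, Or.inr (Or.inl hT)⟩
  · push Not at hj
    obtain ⟨h2, hi, hk, hinj, hone⟩ := h.structure_of_forall_finrank_lt hι hd hbotU htopD (i := i)
      fun j => by have := hmaxU j; have := hj j; omega
    rw [Subspace.dual_finrank_eq] at h2
    obtain ⟨U', V', hU', hV', hT⟩ := exists_typeA (U := U) (V := V) e h2 (i := i)
      (Subspace.dualAnnihilator_inj.1 (hi.trans dualAnnihilator_bot.symm))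
      (fun k hk' => Subspace.dualAnnihilator_inj.1 ((hk k hk').trans dualAnnihilator_top.symm))
      (fun j k hjk => hinj (by simp only [hjk]))
      (fun j => by have := hUr j; have := hone j; omega)
    exact ⟨U', V', Or.inl ⟨hU', hV'⟩, Or.inl hT⟩

theorem isEquivToType_of_sameMultiplicity
    (h : SameMultiplicity (fun i => (V i).dualAnnihilator) (fun i => (U i).dualAnnihilator))
    (hUV : ¬ TupleEquiv U V) (hbot : ∀ x, (∀ i, x ∈ V i) → (∀ i, x ∈ U i) → x = 0)
    (htop : ∀ T, (∀ i, V i ≤ T) → (∀ i, U i ≤ T) → T = ⊤) : IsEquivToType e f U V := by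
  obtain ⟨i, -, hi⟩ := Finset.univ.exists_max_image
    (fun i => finrank K (V i).dualAnnihilator) ⟨0, Finset.mem_univ _⟩
  obtain ⟨j, -, hj⟩ := Finset.univ.exists_max_image
    (fun i => finrank K (U i).dualAnnihilator) ⟨0, Finset.mem_univ _⟩
  have hi := fun k => hi k (Finset.mem_univ k)
  have hj := fun k => hj k (Finset.mem_univ k)
  rcases le_total (finrank K (U j).dualAnnihilator) (finrank K (V i).dualAnnihilator) with hle | hle
  · exact isEquivToType_of_max e f h hUV hbot htop hi fun k => (hj k).trans hle
  · exact (isEquivToType_of_max e f h.symm (fun h => hUV h.symm) (fun x h1 h2 => hbot x h2 h1)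
      (fun T h1 h2 => htop T h2 h1) hj fun k => (hi k).trans hle).symm

end Dual

/-! ### Counting in kernels of functionals -/

section Count

variable [Finite K]

/-- The kernel of `g` contains `P` or cuts it in a hyperplane; writing the ratio as an affine
function of the indicator lets the constant terms cancel in sums of equal length. -/
theorem card_inf_ker_div_card (P : Submodule K W) [FiniteDimensional K P] (g : Dual K W) :
    (Nat.card (P ⊓ LinearMap.ker g : Submodule K W) : ℝ) / Nat.card P =
      1 / Nat.card K + (1 - 1 / Nat.card K) *
        Set.indicator {P : Submodule K W | P ≤ LinearMap.ker g} (fun _ => (1 : ℝ)) P := by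
  have : Finite P := Module.finite_of_finite K
  have hK : (Nat.card K : ℝ) ≠ 0 := Nat.cast_ne_zero.2 Nat.card_pos.ne'
  have hP : (Nat.card P : ℝ) ≠ 0 := Nat.cast_ne_zero.2 Nat.card_pos.ne'
  by_cases hle : P ≤ LinearMap.ker g
  · rw [inf_eq_left.2 hle, Set.indicator_of_mem (by exact hle), div_self hP]
    ring
  · rw [Set.indicator_of_notMem (by exact hle)]
    have hne : g.domRestrict P ≠ 0 := by
      intro h0
      refine hle fun x hx => ?_
      exact LinearMap.congr_fun h0 ⟨x, hx⟩
    have h1 := Submodule.card_eq_card_quotient_mul_card (LinearMap.ker (g.domRestrict P))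
    rw [Nat.card_congr ((g.domRestrict P).quotKerEquivOfSurjective
      (LinearMap.surjective hne)).toEquiv] at h1
    have h2 : Nat.card (LinearMap.ker (g.domRestrict P)) =
        Nat.card (P ⊓ LinearMap.ker g : Submodule K W) := by
      rw [LinearMap.ker_domRestrict]
      exact Nat.card_congr (Submodule.equivSubtypeMap P _).toEquiv |>.trans
        (by rw [Submodule.map_comap_subtype])
    rw [h2] at h1
    rw [h1] at hP ⊢
    push_cast at hP ⊢
    have h3 := left_ne_zero_of_mul hP
    field_simp
    simp

theorem IsSolution.ncard_le_ker_eq {m : ℕ} {U V : Fin m → Submodule K W}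
    (hU : ∀ i, FiniteDimensional K (U i)) (hV : ∀ i, FiniteDimensional K (V i))
    (h : IsSolution U V) (g : Dual K W) :
    {i | V i ≤ LinearMap.ker g}.ncard = {i | U i ≤ LinearMap.ker g}.ncard := by
  classical
  have hfinU : ∀ i, Finite (U i) := fun i => Module.finite_of_finite K
  have hfinV : ∀ i, Finite (V i) := fun i => Module.finite_of_finite K
  -- `W` may be infinite, so the summation over ker g is restricted to the finite union of all the
  -- spaces.
  have hXfin : ((⋃ i, (U i : Set W)) ∪ ⋃ i, (V i : Set W)).Finite :=
    (Set.finite_iUnion fun i => Set.toFinite _).union (Set.finite_iUnion fun i => Set.toFinite _)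
  set X := hXfin.toFinset.filter fun w => w ∈ LinearMap.ker g with hX
  have hsum : ∀ P : Submodule K W, (∀ x ∈ P, x ∈ hXfin.toFinset) →
      ∑ w ∈ X, (1 / (Nat.card P : ℝ)) * Set.indicator (P : Set W) (fun _ => (1 : ℝ)) w =
        (Nat.card (P ⊓ LinearMap.ker g : Submodule K W) : ℝ) / Nat.card P := by
    intro P hP
    rw [← Finset.mul_sum, Finset.sum_indicator_eq_sum_filter, Finset.sum_const, nsmul_eq_mul,
      mul_one, one_div_mul_eq_div]
    congr 2
    refine (Nat.subtype_card _ fun x => ?_).symm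
    simp only [hX, Finset.mem_filter, SetLike.mem_coe, mem_inf]
    exact ⟨fun hx => ⟨hx.2, hx.1.2⟩, fun hx => ⟨⟨hP x hx.1, hx.2⟩, hx.1⟩⟩
  have h1 := Finset.sum_congr rfl fun w (_ : w ∈ X) => h w
  rw [Finset.sum_comm, Finset.sum_comm (s := X)] at h1
  rw [Finset.sum_congr rfl fun i _ => (hsum (V i) fun x hx => by
      simp only [Set.Finite.mem_toFinset]; exact Or.inr (Set.mem_iUnion.2 ⟨i, hx⟩)),
    Finset.sum_congr rfl fun i _ => (hsum (U i) fun x hx => by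
      simp only [Set.Finite.mem_toFinset]; exact Or.inl (Set.mem_iUnion.2 ⟨i, hx⟩)),
    Finset.sum_congr rfl fun i _ => card_inf_ker_div_card (V i) g,
    Finset.sum_congr rfl fun i _ => card_inf_ker_div_card (U i) g,
    Finset.sum_add_distrib, Finset.sum_add_distrib, add_right_inj, ← Finset.mul_sum,
    ← Finset.mul_sum] at h1
  have hq : (1 : ℝ) < Nat.card K := by exact_mod_cast Finite.one_lt_card
  have h2 := mul_left_cancel₀ (sub_ne_zero.2 (by
    rw [ne_comm]; exact ((div_lt_one (by linarith)).2 hq).ne)) h1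
  have h3 : ∀ T : Fin m → Submodule K W,
      ∑ i, Set.indicator {P : Submodule K W | P ≤ LinearMap.ker g} (fun _ => (1 : ℝ)) (T i) =
        {i | T i ≤ LinearMap.ker g}.ncard := by
    intro T
    rw [Set.ncard_eq_toFinset_card']
    simp [Set.indicator_apply]
  rw [h3, h3] at h2
  exact_mod_cast h2

end Count

theorem IsNontrivialSolution.isEquivToType [Finite K]
    (e : Fin (Nat.card K + 1) ≃ Projectivization K (Fin 2 → K)) (f : Fin (Nat.card K) ≃ K)
    {U V : Fin (Nat.card K + 1) → Submodule K W}
    (hU : ∀ i, FiniteDimensional K (U i)) (hV : ∀ i, FiniteDimensional K (V i))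
    (h : IsNontrivialSolution U V) : IsEquivToType e f U V := by
  obtain ⟨hsol, hne⟩ := h
  obtain ⟨C, hC⟩ := (⨅ i, U i ⊓ V i).exists_isCompl
  set S := ⨅ i, U i ⊓ V i with hS
  set X := ⨆ i, U i ⊔ V i with hX
  have hXfin : FiniteDimensional K X := by rw [hX]; infer_instance
  have hSU : ∀ i, S ≤ U i := fun i => (iInf_le _ i).trans inf_le_left
  have hSV : ∀ i, S ≤ V i := fun i => (iInf_le _ i).trans inf_le_right
  have hUX : ∀ i, U i ≤ X := fun i => le_sup_left.trans (le_iSup (fun i => U i ⊔ V i) i)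
  have hVX : ∀ i, V i ≤ X := fun i => le_sup_right.trans (le_iSup (fun i => U i ⊔ V i) i)
  set Q := C ⊓ X with hQ
  have hQfin : FiniteDimensional K Q := finiteDimensional_of_le inf_le_right
  have hSQ : S ⊓ Q = ⊥ := by rw [hQ, ← inf_assoc, hC.inf_eq_bot, bot_inf_eq]
  -- By the modular law, spaces between `S` and `X` are recovered from their traces on `Q`, a
  -- complement of `S` in `X`.
  have hdec : ∀ P : Submodule K W, S ≤ P → P ≤ X → S ⊔ (P.comap Q.subtype).map Q.subtype = P := by
    intro P h1 h2
    rw [map_comap_subtype, hQ, inf_assoc, inf_eq_right.2 h2, ← sup_inf_assoc_of_le _ h1,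
      hC.sup_eq_top, top_inf_eq]
  have hdecU := fun i => hdec _ (hSU i) (hUX i)
  have hdecV := fun i => hdec _ (hSV i) (hVX i)
  suffices hT : IsEquivToType e f (fun i => (U i).comap Q.subtype)
      (fun i => (V i).comap Q.subtype) by
    have := hT.lift (S₀ := S) Q.injective_subtype (by rw [range_subtype, hSQ])
    simpa only [hdecU, hdecV] using this
  refine isEquivToType_of_sameMultiplicity e f ?_ ?_ ?_ ?_
  · intro g
    obtain ⟨g₁, hg₁⟩ := LinearMap.exists_extend g
    -- Composing an extension of `g` with the projection onto `C` along `S` gives a functional on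
    -- `W` that kills `S` and still extends `g`, so it vanishes on `P` exactly when `g` vanishes on
    -- the trace of `P`.
    obtain ⟨g₂, hg₂S, hg₂C⟩ : ∃ g₂ : Module.Dual K W, (∀ x ∈ S, g₂ x = 0) ∧
        ∀ x ∈ C, g₂ x = g₁ x := by
      refine ⟨g₁ ∘ₗ C.subtype ∘ₗ C.projectionOnto S hC.symm, fun x hx => ?_, fun x hx => ?_⟩
      · simp [projectionOnto_apply_of_mem_right hC.symm hx]
      · simp [projectionOnto_apply_of_mem_left hC.symm hx]
    have key : ∀ P : Submodule K W, S ≤ P → P ≤ X →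
        (g ∈ (P.comap Q.subtype).dualAnnihilator ↔ P ≤ LinearMap.ker g₂) := by
      intro P h1 h2
      have hg₂ : ∀ x : Q, g₂ x = g x := fun x => by rw [hg₂C _ x.2.1, ← hg₁]; rfl
      rw [mem_dualAnnihilator]
      constructor
      · intro hg
        rw [← hdec P h1 h2, sup_le_iff]
        refine ⟨hg₂S, ?_⟩
        rintro _ ⟨x, hx, rfl⟩
        exact (hg₂ x).trans (hg x hx)
      · intro hP x hx
        rw [← hg₂]
        exact hP hx
    simp only [key _ (hSU _) (hUX _), key _ (hSV _) (hVX _)]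
    exact hsol.ncard_le_ker_eq hU hV g₂
  · rintro ⟨π, hπ⟩
    exact hne ⟨π, fun i => by
      rw [← hdecV i, ← hdecU]
      exact congrArg (fun P : Submodule K Q => S ⊔ P.map Q.subtype) (hπ i)⟩
  · intro x hxV hxU
    have : (x : W) ∈ S ⊓ Q := ⟨(mem_iInf _).2 fun i => ⟨hxU i, hxV i⟩, x.2⟩
    rw [hSQ, mem_bot] at this
    exact Subtype.ext this
  · intro T hTV hTU
    have h1 : X ≤ S ⊔ T.map Q.subtype := by
      refine iSup_le fun i => sup_le ?_ ?_
      · rw [← hdecU i]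
        exact sup_le_sup_left (map_mono (hTU i)) _
      · rw [← hdecV i]
        exact sup_le_sup_left (map_mono (hTV i)) _
    rw [eq_top_iff]
    intro x _
    obtain ⟨s, hs, _, ⟨y, hy, rfl⟩, hsy⟩ := mem_sup.1 (h1 x.2.2)
    have h2 : s ∈ S ⊓ Q := ⟨hs, by rw [eq_sub_of_add_eq hsy]; exact sub_mem x.2 y.2⟩
    rw [hSQ, mem_bot] at h2
    rw [h2, zero_add] at hsy
    rwa [← Subtype.ext hsy]

end Reduction

end IsometryEquation

theorem mainTheorem1 {K : Type*} [Field K] [Finite K] {W : Type*} [AddCommGroup W] [Module K W]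
    (e : Fin (Nat.card K + 1) ≃ Projectivization K (Fin 2 → K)) (f : Fin (Nat.card K) ≃ K)
    (U V : Fin (Nat.card K + 1) → Submodule K W)
    (hU : ∀ i, FiniteDimensional K (U i)) (hV : ∀ i, FiniteDimensional K (V i))
    (h : IsometryEquation.IsNontrivialSolution U V) :
    ∃ U' V' : Fin (Nat.card K + 1) → Submodule K W,
      IsometryEquation.PairEquiv U V U' V' ∧
        (IsometryEquation.IsTypeA e U' V' ∨ IsometryEquation.IsTypeB f U' V' ∨
          IsometryEquation.IsTypeC e U' V') :=
  h.isEquivToType e f hU hV
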